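/- Let $k\ge 1$ and let $f:[-\pi,\pi]^k\to\mathbb{C}$ be in $L^1([-\pi,\pi]^k)$, extended to $\mathbb{R}^k$ by $2\pi$-periodicity in each variable. Suppose that all its Fourier coefficients $$\hat f_{\mathbf j}=\frac{1}{(2\pi)^k}\int_{[-\pi,\pi]^k} f(\boldsymbol\theta)\,e^{\iota\langle \mathbf j,\boldsymbol\theta\rangle}\,d\boldsymbol\theta,\qquad \mathbf j\in\mathbb{Z}^k,\quad \langle \mathbf j,\boldsymbol\theta\rangle=\sum_{t=1}^k j_t\theta_t,\quad \iota^2=-1,$$ are real. For $\mathbf n=(n_1,\dots,n_k)$ with positive integer entries put $N(\mathbf n)=n_1\cdots n_k$ and let $$T_{\mathbf n}[f]=\sum_{|j_1|<n_1}\cdots\sum_{|j_k|<n_k}\hat f_{\mathbf j}\,\bigl(J_{n_1}^{j_1}\otimes\cdots\otimes J_{n_k}^{j_k}\bigr),\qquad Y_{\mathbf n}=Y_{n_1}\otimes\cdots\otimes Y_{n_k},$$ where $J_m^{j}$ is the $m\times m$ matrix whose $(l,h)$ entry is $1$ if $l-h=j$ and $0$ otherwise, and $Y_m$ is the $m\times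 m$ anti-identity matrix (ones on the antidiagonal, zeros elsewhere). Let $\Omega=[-2\pi,0]^k\cup[0,2\pi]^k$ and define $\psi_{|f|}:\Omega\to\mathbb{R}$ by $$\psi_{|f|}(\boldsymbol\theta)=\begin{cases}|f(\boldsymbol\theta)|, & \boldsymbol\theta\in[0,2\pi]^k,\\ -|f(\boldsymbol\theta+(2\pi,\dots,2\pi))|, & \boldsymbol\theta\in[-2\pi,0]^k,\ \boldsymbol\theta\ne\mathbf 0.\end{cases}$$ Then $\{Y_{\mathbf n}T_{\mathbf n}[f]\}_{\mathbf n}$ is distributed in the eigenvalue sense as $\psi_{|f|}$ over $\Omega$. That is, $\psi_{|f|}$ is measurable on $\Omega$, $0<\mu_k(\Omega)<\infty$ for the Lebesgue measure $\mu_k$, and for every continuous $F:\mathbb{C}\to\mathbb{C}$ with compact support $$\lim_{\mathbf n\to\infty}\frac{1}{N(\mathbf n)}\sum_{j=1}^{N(\mathbf n)}F\bigl(\lambda_j(Y_{\mathbf n}T_{\mathbf n}[f])\bigr)=\frac{1}{\mu_k(\Omega)}\int_{\Omega}F\bigl(\psi_{|f|}(\boldsymbol\theta)\bigr)\,d\boldsymbol\theta,$$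 where $\lambda_1(A),\dots,\lambda_{N(\mathbf n)}(A)$ are the eigenvalues of $A$ counted with algebraic multiplicity and $\mathbf n\to\infty$ means $\min_{1\le j\le k}n_j\to\infty$. -/

import Mathlib

namespace MultilevelToeplitz

noncomputable section

/-- The cube `[-π, π]^k`. -/
def cube (k : ℕ) : Set (Fin k → ℝ) :=
  Set.Icc (fun _ => -Real.pi) (fun _ => Real.pi)

/-- The `2π`-periodic extension (in each variable) to `ℝ^k` of a function on `[-π, π]^k`:
each coordinate is moved into `(-π, π]` by a multiple of `2π`. Only the values of `f` on
the cube are used. -/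
def periodicExt {k : ℕ} (f : (Fin k → ℝ) → ℂ) : (Fin k → ℝ) → ℂ :=
  fun θ => f fun i => toIocMod Real.two_pi_pos (-Real.pi) (θ i)

/-- The Fourier coefficients `(2π)^{-k} ∫_{[-π,π]^k} f(θ) exp(i ⟨j, θ⟩) dθ`. -/
def fourierCoefficient {k : ℕ} (f : (Fin k → ℝ) → ℂ) (j : Fin k → ℤ) : ℂ :=
  1 / (2 * (Real.pi : ℂ)) ^ k *
    ∫ θ in cube k, f θ * Complex.exp (Complex.I * ((∑ t, (j t : ℝ) * θ t : ℝ) : ℂ))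

/-- Row and column indices of a multilevel matrix of size `n = (n_1, …, n_k)`: there are
`N(n) = n_1 ⋯ n_k` of them. -/
abbrev MultiIndex {k : ℕ} (n : Fin k → ℕ) : Type := (i : Fin k) → Fin (n i)

/-- The tensor (Kronecker) product `M_1 ⊗ ⋯ ⊗ M_k`, indexed by multi-indices. -/
def tensorProd {k : ℕ} {n : Fin k → ℕ} (M : (i : Fin k) → Matrix (Fin (n i)) (Fin (n i)) ℂ) :
    Matrix (MultiIndex n) (MultiIndex n) ℂ :=
  Matrix.of fun l h => ∏ i, M i (l i) (h i)

/-- The `m × m` matrix `J_m^j` whose `(l, h)` entry is `1` if `l - h = j` and `0` otherwise. -/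
def shiftMatrix (m : ℕ) (j : ℤ) : Matrix (Fin m) (Fin m) ℂ :=
  Matrix.of fun l h => if ((l : ℕ) : ℤ) - ((h : ℕ) : ℤ) = j then 1 else 0

/-- The `m × m` anti-identity (flip) matrix `Y_m`; `Fin.rev l = m - 1 - l`. -/
def antiIdentity (m : ℕ) : Matrix (Fin m) (Fin m) ℂ :=
  Matrix.of fun l h => if h = Fin.rev l then 1 else 0

/-- The multilevel Toeplitz matrix
`T_n[f] = ∑_{|j_1| < n_1} ⋯ ∑_{|j_k| < n_k} f̂_j (J_{n_1}^{j_1} ⊗ ⋯ ⊗ J_{n_k}^{j_k})`. -/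
def toeplitz {k : ℕ} (f : (Fin k → ℝ) → ℂ) (n : Fin k → ℕ) :
    Matrix (MultiIndex n) (MultiIndex n) ℂ :=
  ∑ j ∈ Fintype.piFinset (fun i => Finset.Ioo (-(n i : ℤ)) (n i : ℤ)),
    fourierCoefficient f j • tensorProd fun i => shiftMatrix (n i) (j i)

/-- The multilevel anti-identity `Y_n = Y_{n_1} ⊗ ⋯ ⊗ Y_{n_k}`. -/
def multiAntiIdentity {k : ℕ} (n : Fin k → ℕ) : Matrix (MultiIndex n) (MultiIndex n) ℂ :=
  tensorProd fun i => antiIdentity (n i)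

/-- The domain `[-2π, 0]^k ∪ [0, 2π]^k`. -/
def doubleCube (k : ℕ) : Set (Fin k → ℝ) :=
  Set.Icc (fun _ => -(2 * Real.pi)) (fun _ => 0) ∪ Set.Icc (fun _ => 0) (fun _ => 2 * Real.pi)

open Classical in
/-- `ψ_g(θ) = g(θ)` on `[0, 2π]^k` and `ψ_g(θ) = -g(θ + (2π, …, 2π))` on the rest of
`[-2π, 0]^k ∪ [0, 2π]^k` (values outside this domain play no role). -/
def psi {k : ℕ} (g : (Fin k → ℝ) → ℂ) (θ : Fin k → ℝ) : ℂ :=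
  if θ ∈ Set.Icc (fun _ => (0 : ℝ)) (fun _ => 2 * Real.pi) then g θ
  else -g fun i => θ i + 2 * Real.pi

/-- The functional `η_g(F) = μ_k(D)^{-1} ∫_D F(g(x)) dx`. -/
def eta {k : ℕ} (D : Set (Fin k → ℝ)) (g : (Fin k → ℝ) → ℂ) (F : ℂ → ℂ) : ℂ :=
  1 / ((MeasureTheory.volume D).toReal : ℂ) * ∫ x in D, F (g x)

/-- The sum `∑_{j=1}^{N(n)} F(λ_j(A))` over the eigenvalues of a complex matrix, counted with
algebraic multiplicity. -/
def eigenvalueSum {ι : Type} [Fintype ι] [DecidableEq ι] (A : Matrix ι ι ℂ) (F : ℂ → ℂ) : ℂ :=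
  (A.charpoly.roots.map F).sum

/-- The matrix-sequence `{A_n}_n`, `A_n` of size `N(n) = n_1 ⋯ n_k`, has an asymptotic
eigenvalue distribution described by the (Lebesgue) measurable function `g` on `D`, where
`0 < μ_k(D) < ∞`. The limit `n → ∞` is `min_j n_j → ∞`, i.e. the filter `atTop` for the
componentwise order; sizes with a component `0` are irrelevant for it. -/
def HasEigenvalueDistribution {k : ℕ}
    (A : (n : Fin k → ℕ) → Matrix (MultiIndex n) (MultiIndex n) ℂ)
    (D : Set (Fin k → ℝ)) (g : (Fin k → ℝ) → ℂ) : Prop :=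
  MeasurableSet D ∧ 0 < MeasureTheory.volume D ∧ MeasureTheory.volume D < ⊤ ∧
  AEMeasurable g (MeasureTheory.volume.restrict D) ∧
  ∀ F : ℂ → ℂ, Continuous F → HasCompactSupport F →
    Filter.Tendsto (fun n : Fin k → ℕ => 1 / ((∏ i, n i : ℕ) : ℂ) * eigenvalueSum (A n) F)
      Filter.atTop (nhds (eta D g F))

end

end MultilevelToeplitz

/-!
# Eigenvalue distribution of flipped multilevel Toeplitz matrices

Write `A_n[c]` for the matrix with entries `c (n - 1 - l - h)`, where `c` is the family of Fourier
coefficients; this is the flip times the Toeplitz matrix (`multiAntiIdentity_mul_toeplitz`). It is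
symmetric, and real coefficients make it Hermitian. By Lévy's continuity theorem, applied to the
normalised counting measures of the eigenvalues, it suffices that for every real `t`
`(1 / N(n)) tr exp (i t A_n)` converges to `∫ cos (t |f|)`, the characteristic function of the
equal-weight mixture of the laws of `|f|` and `-|f|` (`tendsto_trace_exp_hankel`).

For a trigonometric polynomial `p` with real coefficients this is a computation of moments
(`tendsto_trace_hankel_pow`). Conjugation by the flip transposes a Toeplitz matrix, so `A_n ^ 2`
is the product of the Toeplitz matrices of `conj p` and `p`. Since `p` has finitely many
frequencies, the rows of `A_n ^ (2r)` away from the boundary of the index box are those of the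
Toeplitz matrix of `|p| ^ (2r)`, while the rows of `A_n ^ (2r + 1)` away from the boundary are
those of the Hankel matrix of `p |p| ^ (2r)`. The former has constant diagonal `∫ |p| ^ (2r)`, the
diagonal of the latter is absolutely summable uniformly in `n`, and a vanishing fraction of the
indices is close to the boundary. Hence even moments converge to those of `|p|` and odd moments
to zero; the spectra being uniformly bounded, the exponential series gives the claim.

An integrable symbol is approximated in `L¹` by such polynomials (`exists_real_trigPoly`), where
uniqueness of Fourier coefficients is what keeps the coefficients real. The error is controlled by
Duhamel's formula and the inequality `|tr (Z A_n[g])| ≤ N(n) ∫ |g|` for contractions `Z`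
(`norm_trace_mul_hankel_le`), which replaces a bound on the trace norm of `A_n[g]`.

Everything takes place on the unit torus with its Haar probability measure; the maps `toTorus` and
`fromTorus` carry the symbol on the cube and the integrals over both halves of the double cube
there.
-/

namespace MultilevelToeplitz

open MeasureTheory UnitAddTorus Filter Topology ComplexConjugate

noncomputable section

variable {k : ℕ}

/-- The unit circle carries its Haar probability measure, as in Mathlib's theory of `mFourier`.
Mathlib's global measure on `AddCircle 1` equals it, but not by definition. -/
local instance circleMeasureSpace : MeasureSpace UnitAddCircle := ⟨AddCircle.haarAddCircle⟩

local instance circleIsAddHaarMeasure : Measure.IsAddHaarMeasure (volume : Measure UnitAddCircle) :=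
  inferInstanceAs (Measure.IsAddHaarMeasure AddCircle.haarAddCircle)

local instance circleIsProbabilityMeasure : IsProbabilityMeasure (volume : Measure UnitAddCircle) :=
  inferInstanceAs (IsProbabilityMeasure AddCircle.haarAddCircle)

local instance circleIsNegInvariant : Measure.IsNegInvariant (volume : Measure UnitAddCircle) :=
  inferInstanceAs (Measure.IsNegInvariant AddCircle.haarAddCircle)

/-! ### Fourier coefficients and trigonometric polynomials on the torus -/

/-- The Fourier coefficient `∫ e^{2πi⟨j, x⟩} g(x) dx` on the unit torus, with the sign of the
exponent that `fourierCoefficient` uses; it is `mFourierCoeff g (-j)`. -/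
def coeff (g : UnitAddTorus (Fin k) → ℂ) (j : Fin k → ℤ) : ℂ :=
  ∫ x, mFourier j x * g x

lemma norm_mFourier_apply (j : Fin k → ℤ) (x : UnitAddTorus (Fin k)) : ‖mFourier j x‖ = 1 := by
  simp only [mFourier, fourier_apply, ContinuousMap.coe_mk, norm_prod, Circle.norm_coe,
    Finset.prod_const_one]

lemma mFourier_sub (i j : Fin k → ℤ) (x : UnitAddTorus (Fin k)) :
    mFourier (i - j) x = mFourier i x * conj (mFourier j x) := by
  rw [sub_eq_add_neg, mFourier_add, mFourier_neg]

lemma mFourier_apply_neg (j : Fin k → ℤ) (x : UnitAddTorus (Fin k)) :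
    mFourier j (-x) = conj (mFourier j x) := by
  rw [← mFourier_neg]
  simp [mFourier, fourier_apply]

lemma integrable_mFourier_mul {g : UnitAddTorus (Fin k) → ℂ} (hg : Integrable g)
    (j : Fin k → ℤ) : Integrable fun x => mFourier j x * g x :=
  hg.bdd_mul (c := 1) (mFourier j).continuous.aestronglyMeasurable
    (.of_forall fun x => (norm_mFourier_apply j x).le)

lemma integrable_continuousMap (p : C(UnitAddTorus (Fin k), ℂ)) : Integrable p :=
  p.continuous.integrable_of_hasCompactSupport (HasCompactSupport.of_compactSpace _)

lemma integral_mFourier (m : Fin k → ℤ) :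
    ∫ x, mFourier m x = if m = 0 then 1 else 0 := by
  have h := orthonormal_iff_ite.mp (orthonormal_mFourier (d := Fin k)) 0 m
  simp only [ContinuousMap.inner_toLp, mFourier_zero] at h
  simpa [eq_comm] using h

lemma coeff_mFourier (m j : Fin k → ℤ) : coeff (mFourier m) j = if j = -m then 1 else 0 := by
  simp_rw [coeff, ← mFourier_add, integral_mFourier, add_eq_zero_iff_eq_neg]

lemma coeff_add {g h : UnitAddTorus (Fin k) → ℂ} (hg : Integrable g) (hh : Integrable h)
    (j : Fin k → ℤ) : coeff (g + h) j = coeff g j + coeff h j := by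
  simp_rw [coeff, Pi.add_apply, mul_add]
  exact integral_add (integrable_mFourier_mul hg j) (integrable_mFourier_mul hh j)

lemma coeff_sub {g h : UnitAddTorus (Fin k) → ℂ} (hg : Integrable g) (hh : Integrable h)
    (j : Fin k → ℤ) : coeff (g - h) j = coeff g j - coeff h j := by
  simp_rw [coeff, Pi.sub_apply, mul_sub]
  exact integral_sub (integrable_mFourier_mul hg j) (integrable_mFourier_mul hh j)

lemma coeff_smul (a : ℂ) (g : UnitAddTorus (Fin k) → ℂ) (j : Fin k → ℤ) :
    coeff (a • g) j = a * coeff g j := by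
  simp_rw [coeff, Pi.smul_apply, smul_eq_mul, mul_left_comm _ a]
  exact integral_const_mul _ _

lemma coeff_conj_neg (g : UnitAddTorus (Fin k) → ℂ) (j : Fin k → ℤ) :
    coeff (fun x => conj (g (-x))) j = conj (coeff g j) := by
  rw [coeff, coeff, ← integral_conj, ← integral_neg_eq_self]
  simp [mFourier_apply_neg]

lemma coeff_star (p : C(UnitAddTorus (Fin k), ℂ)) (j : Fin k → ℤ) :
    coeff (star p : C(_, ℂ)) j = conj (coeff p (-j)) := by
  rw [coeff, coeff, ← integral_conj]
  simp [mFourier_neg]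

variable (k) in
/-- The trigonometric polynomials on the torus. -/
abbrev trigPoly : Submodule ℂ C(UnitAddTorus (Fin k), ℂ) :=
  Submodule.span ℂ (Set.range mFourier)

lemma mul_mem_trigPoly {p q : C(UnitAddTorus (Fin k), ℂ)} (hp : p ∈ trigPoly k)
    (hq : q ∈ trigPoly k) : p * q ∈ trigPoly k := by
  rw [trigPoly, ← mFourierSubalgebra_coe] at *
  exact (mFourierSubalgebra (Fin k)).mul_mem hp hq

lemma star_mem_trigPoly {p : C(UnitAddTorus (Fin k), ℂ)} (hp : p ∈ trigPoly k) :
    star p ∈ trigPoly k := by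
  rw [trigPoly, ← mFourierSubalgebra_coe] at *
  exact (mFourierSubalgebra (Fin k)).star_mem' hp

lemma one_mem_trigPoly : (1 : C(UnitAddTorus (Fin k), ℂ)) ∈ trigPoly k :=
  mFourier_zero (d := Fin k) ▸ Submodule.subset_span ⟨0, rfl⟩

lemma finite_support_coeff {p : C(UnitAddTorus (Fin k), ℂ)} (hp : p ∈ trigPoly k) :
    (Function.support (coeff p)).Finite := by
  induction hp using Submodule.span_induction with
  | mem x h =>
    obtain ⟨m, rfl⟩ := h
    refine (Set.finite_singleton (-m)).subset fun j hj => ?_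
    by_contra hne
    exact hj ((coeff_mFourier m j).trans (if_neg hne))
  | zero => simp [coeff, Function.support]
  | add x y _ _ hx hy =>
    refine (hx.union hy).subset (subset_trans (fun j hj => ?_) (Function.support_add _ _))
    rwa [Function.mem_support, ContinuousMap.coe_add,
      coeff_add (integrable_continuousMap x) (integrable_continuousMap y)] at hj
  | smul a x _ hx =>
    refine hx.subset fun j hj h0 => hj ?_
    rw [ContinuousMap.coe_smul, coeff_smul, h0, mul_zero]

/-- The convolution theorem when one factor is a trigonometric polynomial. -/
lemma hasSum_coeff_mul {p : C(UnitAddTorus (Fin k), ℂ)} (hp : p ∈ trigPoly k)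
    (u : C(UnitAddTorus (Fin k), ℂ)) (j : Fin k → ℤ) :
    HasSum (fun m => coeff p m * coeff u (j - m)) (coeff (p * u : C(_, ℂ)) j) := by
  induction hp using Submodule.span_induction with
  | mem x h =>
    obtain ⟨m, rfl⟩ := h
    have h1 : coeff (mFourier m * u : C(_, ℂ)) j = coeff (mFourier m) (-m) * coeff u (j - -m) := by
      rw [coeff_mFourier, if_pos rfl, one_mul, sub_neg_eq_add]
      simp_rw [coeff, mFourier_add, ContinuousMap.mul_apply, mul_assoc]
    rw [h1]
    refine hasSum_single (-m) fun i hi => ?_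
    rw [coeff_mFourier, if_neg hi, zero_mul]
  | zero => simp [coeff]
  | add x y _ _ hx hy =>
    rw [add_mul, ContinuousMap.coe_add, ContinuousMap.coe_add,
      coeff_add (integrable_continuousMap _) (integrable_continuousMap _)]
    simp_rw [coeff_add (integrable_continuousMap x) (integrable_continuousMap y), add_mul]
    exact hx.add hy
  | smul a x _ hx =>
    rw [smul_mul_assoc, ContinuousMap.coe_smul, ContinuousMap.coe_smul, coeff_smul]
    simp_rw [coeff_smul, mul_assoc]
    exact hx.mul_left a

/-- Fourier coefficients determine an integrable function on the torus: its integral against a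
continuous function vanishes by Stone–Weierstrass, and indicators of compact sets are limits of
continuous functions. -/
lemma ae_eq_zero_of_coeff_eq_zero {g : UnitAddTorus (Fin k) → ℂ} (hg : Integrable g)
    (h0 : ∀ j, coeff g j = 0) : g =ᵐ[volume] 0 := by
  have key : ∀ φ : C(UnitAddTorus (Fin k), ℂ), ∫ x, φ x * g x = 0 := by
    intro φ
    have hint : ∀ φ : C(UnitAddTorus (Fin k), ℂ), Integrable fun x => φ x * g x := fun φ =>
      hg.bdd_mul (c := ‖φ‖) φ.continuous.aestronglyMeasurable
        (.of_forall fun x => φ.norm_coe_le_norm x)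
    have hcont : Continuous fun φ : C(UnitAddTorus (Fin k), ℂ) => ∫ x, φ x * g x := by
      refine continuous_iff_continuousAt.mpr fun φ₀ => ?_
      rw [ContinuousAt, tendsto_iff_norm_sub_tendsto_zero]
      have hlim : Tendsto (fun φ : C(UnitAddTorus (Fin k), ℂ) => ‖φ - φ₀‖ * ∫ x, ‖g x‖)
          (𝓝 φ₀) (𝓝 0) := by
        have : Tendsto (fun φ : C(UnitAddTorus (Fin k), ℂ) => ‖φ - φ₀‖) (𝓝 φ₀) (𝓝 0) :=
          tendsto_iff_norm_sub_tendsto_zero.mp tendsto_id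
        simpa using this.mul_const _
      refine squeeze_zero (fun _ => norm_nonneg _) (fun φ => ?_) hlim
      rw [← integral_sub (hint φ) (hint φ₀), ← integral_const_mul]
      refine norm_integral_le_of_norm_le (hg.norm.const_mul _) (.of_forall fun x => ?_)
      rw [← sub_mul, norm_mul]
      exact mul_le_mul_of_nonneg_right ((φ - φ₀).norm_coe_le_norm x) (norm_nonneg _)
    have hφ : φ ∈ (trigPoly k).topologicalClosure := by
      rw [trigPoly, span_mFourier_closure_eq_top]; trivial
    refine closure_minimal (t := {φ : C(UnitAddTorus (Fin k), ℂ) | ∫ x, φ x * g x = 0})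
      (fun q hq => ?_) (isClosed_singleton.preimage hcont) hφ
    induction hq using Submodule.span_induction with
    | mem x h => obtain ⟨m, rfl⟩ := h; exact h0 m
    | zero => simp
    | add x y _ _ hx hy =>
      simp only [Set.mem_ofPred_eq, ContinuousMap.add_apply, add_mul] at *
      rw [integral_add (hint x) (hint y), hx, hy, add_zero]
    | smul a x _ hx =>
      simp only [Set.mem_ofPred_eq, ContinuousMap.smul_apply, smul_eq_mul, mul_assoc] at *
      rw [integral_const_mul, hx, mul_zero]
  refine ae_eq_zero_of_forall_setIntegral_isCompact_eq_zero' hg.locallyIntegrable fun s hs => ?_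
  have hδ : ∀ n : ℕ, (0 : ℝ) < 1 / ((n : ℝ) + 1) := fun n => Nat.one_div_pos_of_nat
  have hlim := thickenedIndicator_tendsto_indicator_closure hδ
    tendsto_one_div_add_atTop_nhds_zero_nat s
  rw [hs.isClosed.closure_eq, tendsto_pi_nhds] at hlim
  have h1 : Tendsto (fun n : ℕ => ∫ x, ((thickenedIndicator (hδ n) s x : ℝ) : ℂ) * g x) atTop
      (𝓝 (∫ x, s.indicator g x)) := by
    refine tendsto_integral_of_dominated_convergence (fun x => ‖g x‖) (fun n => ?_) hg.norm
      (fun n => .of_forall fun x => ?_) (.of_forall fun x => ?_)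
    · exact (Continuous.aestronglyMeasurable (by fun_prop)).mul hg.aestronglyMeasurable
    · rw [norm_mul]
      refine mul_le_of_le_one_left (norm_nonneg _) ?_
      simpa using thickenedIndicator_le_one (hδ n) s x
    · have h2 := (Complex.continuous_ofReal.tendsto _).comp
        ((NNReal.continuous_coe.tendsto _).comp (hlim x))
      have h3 := h2.mul_const (g x)
      have h4 : s.indicator g x =
          (((s.indicator (fun _ => (1 : NNReal)) x : NNReal) : ℝ) : ℂ) * g x := by
        by_cases hx : x ∈ s
        · simp [hx]
        · simp [hx]
      rw [h4]
      exact h3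
  rw [integral_indicator hs.measurableSet] at h1
  refine tendsto_nhds_unique h1 ?_
  have h4 : ∀ n : ℕ, ∫ x, ((thickenedIndicator (hδ n) s x : ℝ) : ℂ) * g x = 0 := fun n =>
    key ⟨fun x => ((thickenedIndicator (hδ n) s x : ℝ) : ℂ), by fun_prop⟩
  simp_rw [h4]
  exact tendsto_const_nhds

lemma exists_trigPoly_integral_norm_sub_le {g : UnitAddTorus (Fin k) → ℂ} (hg : Integrable g)
    {ε : ℝ} (hε : 0 < ε) : ∃ q ∈ trigPoly k, ∫ x, ‖g x - q x‖ ≤ ε := by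
  obtain ⟨φ, hφ, hφi⟩ := hg.exists_boundedContinuous_integral_sub_le (half_pos hε)
  have hmem : φ.toContinuousMap ∈ closure (trigPoly k : Set C(UnitAddTorus (Fin k), ℂ)) := by
    rw [← Submodule.topologicalClosure_coe, trigPoly, span_mFourier_closure_eq_top]; trivial
  obtain ⟨q, hq, hd⟩ := Metric.mem_closure_iff.mp hmem (ε / 2) (half_pos hε)
  refine ⟨q, hq, ?_⟩
  have hqi := integrable_continuousMap q
  have h1 : ∫ x, ‖φ x - q x‖ ≤ ε / 2 := by
    have : ∫ x, ‖φ x - q x‖ ≤ ∫ _ : UnitAddTorus (Fin k), ε / 2 := by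
      refine integral_mono (hφi.sub hqi).norm (integrable_const _) fun x => ?_
      rw [← dist_eq_norm]
      exact (ContinuousMap.dist_apply_le_dist x).trans hd.le
    simpa using this
  calc ∫ x, ‖g x - q x‖ ≤ ∫ x, (‖g x - φ x‖ + ‖φ x - q x‖) :=
        integral_mono (hg.sub hqi).norm ((hg.sub hφi).norm.add (hφi.sub hqi).norm)
          fun x => norm_sub_le_norm_sub_add_norm_sub _ _ _
    _ = (∫ x, ‖g x - φ x‖) + ∫ x, ‖φ x - q x‖ :=
        integral_add (hg.sub hφi).norm (hφi.sub hqi).norm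
    _ ≤ ε := by linarith

/-- A function with real Fourier coefficients is the `L¹`-limit of trigonometric polynomials with
real coefficients. By uniqueness of Fourier coefficients `g(x) = conj (g(-x))` almost everywhere,
so an approximant can be averaged with its image under this symmetry. -/
lemma exists_real_trigPoly {g : UnitAddTorus (Fin k) → ℂ} (hg : Integrable g)
    (hreal : ∀ j, (coeff g j).im = 0) {ε : ℝ} (hε : 0 < ε) :
    ∃ p ∈ trigPoly k, (∀ j, (coeff p j).im = 0) ∧ ∫ x, ‖g x - p x‖ ≤ ε := by
  obtain ⟨q, hq, hqε⟩ := exists_trigPoly_integral_norm_sub_le hg hε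
  have hg' : Integrable fun x => conj (g (-x)) :=
    (LinearIsometryEquiv.integrable_comp_iff Complex.conjLIE).mpr hg.comp_neg
  have hsymm : ∀ᵐ x, conj (g (-x)) = g x := by
    have h := ae_eq_zero_of_coeff_eq_zero (hg'.sub hg) fun j => by
      rw [coeff_sub hg' hg, coeff_conj_neg, Complex.conj_eq_iff_im.mpr (hreal j), sub_self]
    filter_upwards [h] with x hx
    exact sub_eq_zero.mp hx
  let q' : C(UnitAddTorus (Fin k), ℂ) := ⟨fun x => conj (q (-x)), by fun_prop⟩
  have hq' : q' ∈ trigPoly k := by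
    have : ∀ q ∈ trigPoly k, ∃ r ∈ trigPoly k, ∀ x, r x = conj (q (-x)) := by
      intro q hq
      induction hq using Submodule.span_induction with
      | mem x h =>
        obtain ⟨m, rfl⟩ := h
        exact ⟨mFourier m, Submodule.subset_span ⟨m, rfl⟩, fun x => by simp [mFourier_apply_neg]⟩
      | zero => exact ⟨0, zero_mem _, by simp⟩
      | add x y _ _ hx hy =>
        obtain ⟨r, hr, hr'⟩ := hx
        obtain ⟨s, hs, hs'⟩ := hy
        exact ⟨r + s, add_mem hr hs, by simp [hr', hs']⟩
      | smul a x _ hx =>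
        obtain ⟨r, hr, hr'⟩ := hx
        exact ⟨conj a • r, Submodule.smul_mem _ _ hr, by simp [hr']⟩
    obtain ⟨r, hr, hr'⟩ := this q hq
    convert hr
    ext x
    exact (hr' x).symm
  have hqi := integrable_continuousMap q
  have hqi' := integrable_continuousMap q'
  refine ⟨(2⁻¹ : ℂ) • (q + q'), Submodule.smul_mem _ _ (add_mem hq hq'), fun j => ?_, ?_⟩
  · rw [ContinuousMap.coe_smul, coeff_smul, ContinuousMap.coe_add, coeff_add hqi hqi',
      show coeff q' j = conj (coeff q j) from coeff_conj_neg q j, Complex.add_conj]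
    simp
  · have hflip : ∫ x, ‖g x - q' x‖ = ∫ x, ‖g x - q x‖ := by
      rw [← integral_neg_eq_self fun x => ‖g x - q x‖]
      refine integral_congr_ae ?_
      filter_upwards [hsymm] with x hx
      have : g x - q' x = conj (g (-x) - q (-x)) := by
        rw [map_sub, hx]; rfl
      rw [this, RCLike.norm_conj]
    calc ∫ x, ‖g x - ((2⁻¹ : ℂ) • (q + q')) x‖
        ≤ ∫ x, (2⁻¹ * ‖g x - q x‖ + 2⁻¹ * ‖g x - q' x‖) := by
          refine integral_mono (hg.sub (integrable_continuousMap _)).norm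
            (((hg.sub hqi).norm.const_mul _).add ((hg.sub hqi').norm.const_mul _)) fun x => ?_
          have : g x - ((2⁻¹ : ℂ) • (q + q')) x
              = (2⁻¹ : ℂ) * (g x - q x) + (2⁻¹ : ℂ) * (g x - q' x) := by
            simp only [ContinuousMap.smul_apply, ContinuousMap.add_apply, smul_eq_mul]
            ring
          simp only [this]
          refine (norm_add_le _ _).trans (le_of_eq ?_)
          simp
      _ = 2⁻¹ * (∫ x, ‖g x - q x‖) + 2⁻¹ * ∫ x, ‖g x - q' x‖ := by
          rw [← integral_const_mul, ← integral_const_mul]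
          exact integral_add ((hg.sub hqi).norm.const_mul _) ((hg.sub hqi').norm.const_mul _)
      _ ≤ ε := by rw [hflip]; linarith

/-! ### Hankel matrices and their powers -/

/-- A multi-index as an integer vector. -/
def MultiIndex.toInt {n : Fin k → ℕ} (l : MultiIndex n) : Fin k → ℤ := fun i => ((l i : ℕ) : ℤ)

/-- The flip `l ↦ n - 1 - l` of multi-indices. -/
def MultiIndex.rev {n : Fin k → ℕ} (l : MultiIndex n) : MultiIndex n := fun i => Fin.rev (l i)

/-- The multilevel Hankel matrix with entries `c (n - 1 - l - h)`: this is the flip matrix times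
the multilevel Toeplitz matrix with entries `c (l - h)`. -/
def hankel (c : (Fin k → ℤ) → ℂ) (n : Fin k → ℕ) : Matrix (MultiIndex n) (MultiIndex n) ℂ :=
  Matrix.of fun l h => c (l.rev.toInt - h.toInt)

/-- The multi-indices at distance at least `D` from the boundary of the index box. -/
def MultiIndex.IsInterior {n : Fin k → ℕ} (D : ℕ) (l : MultiIndex n) : Prop :=
  ∀ i, D ≤ (l i : ℕ) ∧ (l i : ℕ) + D < n i

/-- The rows of `M` with index in the `D`-interior are those of the Toeplitz matrix of `u`. -/
def ToeplitzOn {n : Fin k → ℕ} (D : ℕ) (M : Matrix (MultiIndex n) (MultiIndex n) ℂ)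
    (u : C(UnitAddTorus (Fin k), ℂ)) : Prop :=
  ∀ l h, l.IsInterior D → M l h = coeff u (l.toInt - h.toInt)

/-- The rows of `M` with index in the `D`-interior are those of the Hankel matrix of `u`. -/
def HankelOn {n : Fin k → ℕ} (D : ℕ) (M : Matrix (MultiIndex n) (MultiIndex n) ℂ)
    (u : C(UnitAddTorus (Fin k), ℂ)) : Prop :=
  ∀ l h, l.IsInterior D → M l h = coeff u (l.rev.toInt - h.toInt)

variable {n : Fin k → ℕ}

lemma MultiIndex.rev_rev (l : MultiIndex n) : l.rev.rev = l := by
  ext i; simp [MultiIndex.rev]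

lemma MultiIndex.rev_involutive : Function.Involutive (MultiIndex.rev (n := n)) :=
  MultiIndex.rev_rev

lemma MultiIndex.toInt_rev (l : MultiIndex n) (i : Fin k) :
    l.rev.toInt i = n i - 1 - l.toInt i := by
  have := (l i).isLt
  simp only [MultiIndex.toInt, MultiIndex.rev, Fin.val_rev]
  omega

lemma MultiIndex.toInt_injective : Function.Injective (MultiIndex.toInt (n := n)) := by
  intro l h hlh
  ext i
  have := congrFun hlh i
  simpa [MultiIndex.toInt] using this

lemma MultiIndex.IsInterior.rev {D : ℕ} {l : MultiIndex n} (hl : l.IsInterior D) :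
    l.rev.IsInterior D := by
  intro i
  have h1 := hl i
  have h2 := (l i).isLt
  simp only [MultiIndex.rev, Fin.val_rev]
  omega

lemma hankel_isHermitian {c : (Fin k → ℤ) → ℂ} (hc : ∀ j, (c j).im = 0) (n : Fin k → ℕ) :
    (hankel c n).IsHermitian := by
  ext l h
  have : h.rev.toInt - l.toInt = l.rev.toInt - h.toInt := by
    ext i
    simp only [Pi.sub_apply, MultiIndex.toInt_rev]
    ring
  simp [hankel, Matrix.conjTranspose_apply, this, Complex.conj_eq_iff_im.mpr (hc _)]

/-- In a row far enough from the boundary the product of two Toeplitz matrices is the Toeplitz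
matrix of the product symbol, since the convolution there is not truncated. -/
lemma sum_coeff_mul_of_toeplitzOn {p u : C(UnitAddTorus (Fin k), ℂ)} (hp : p ∈ trigPoly k)
    {D₀ D : ℕ} (hD₀ : ∀ j, coeff p j ≠ 0 → ∀ i, |j i| ≤ D₀)
    {M : Matrix (MultiIndex n) (MultiIndex n) ℂ} (hM : ToeplitzOn D M u)
    {l : MultiIndex n} (hl : l.IsInterior (D + D₀)) (h : MultiIndex n) :
    ∑ m, coeff p (l.toInt - m.toInt) * M m h = coeff (p * u : C(_, ℂ)) (l.toInt - h.toInt) := by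
  have hinj : Function.Injective fun m : MultiIndex n => l.toInt - m.toInt :=
    sub_right_injective.comp MultiIndex.toInt_injective
  have hsum := hasSum_coeff_mul hp u (l.toInt - h.toInt)
  rw [← hinj.hasSum_iff] at hsum
  · refine (Finset.sum_congr rfl fun m _ => ?_).trans ((hasSum_fintype _).unique hsum)
    simp only [Function.comp]
    by_cases h0 : coeff p (l.toInt - m.toInt) = 0
    · rw [h0, zero_mul, zero_mul]
    · have hm : m.IsInterior D := by
        intro i
        have h1 := abs_le.mp (hD₀ _ h0 i)
        have h2 := hl i
        simp only [Pi.sub_apply, MultiIndex.toInt] at h1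
        omega
      rw [hM m h hm, sub_sub_sub_cancel_left]
  · -- a frequency outside the truncated sum would move `l` out of the index box
    intro j hj
    by_contra hne
    have h1 := hD₀ j (left_ne_zero_of_mul hne)
    have h3 : ∀ i, 0 ≤ l.toInt i - j i ∧ l.toInt i - j i < n i := fun i => by
      have h1 := abs_le.mp (h1 i)
      have h2 := hl i
      simp only [MultiIndex.toInt]
      omega
    refine hj ⟨fun i => ⟨(l.toInt i - j i).toNat, by have := h3 i; omega⟩, ?_⟩
    ext i
    have := h3 i
    simp only [Pi.sub_apply, MultiIndex.toInt] at this ⊢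
    omega

lemma ToeplitzOn.hankel_mul {p u : C(UnitAddTorus (Fin k), ℂ)} (hp : p ∈ trigPoly k)
    {D₀ D : ℕ} (hD₀ : ∀ j, coeff p j ≠ 0 → ∀ i, |j i| ≤ D₀)
    {M : Matrix (MultiIndex n) (MultiIndex n) ℂ} (hM : ToeplitzOn D M u) :
    HankelOn (D + D₀) (hankel (coeff p) n * M) (p * u) := fun l h hl => by
  rw [Matrix.mul_apply]
  exact sum_coeff_mul_of_toeplitzOn hp hD₀ hM hl.rev h

/-- The flip of the second factor is absorbed into the first one, whose symbol thereby becomes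
`conj p`, because the coefficients of `p` are real. -/
lemma HankelOn.hankel_mul {p u : C(UnitAddTorus (Fin k), ℂ)} (hp : p ∈ trigPoly k)
    (hreal : ∀ j, (coeff p j).im = 0) {D₀ D : ℕ} (hD₀ : ∀ j, coeff p j ≠ 0 → ∀ i, |j i| ≤ D₀)
    {M : Matrix (MultiIndex n) (MultiIndex n) ℂ} (hM : HankelOn D M u) :
    ToeplitzOn (D + D₀) (hankel (coeff p) n * M) (star p * u) := fun l h hl => by
  have hstar : ∀ j, coeff (star p : C(_, ℂ)) j = coeff p (-j) := fun j => by
    rw [coeff_star, Complex.conj_eq_iff_im.mpr (hreal _)]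
  have hM' : ToeplitzOn D (M.submatrix MultiIndex.rev id) u := fun l h hl => by
    simpa [MultiIndex.rev_rev] using hM l.rev h hl.rev
  rw [← sum_coeff_mul_of_toeplitzOn (star_mem_trigPoly hp) (D₀ := D₀)
      (fun j hj i => by rw [hstar] at hj; simpa using hD₀ _ hj i) hM' hl h,
    Matrix.mul_apply, ← Equiv.sum_comp MultiIndex.rev_involutive.toPerm]
  refine Finset.sum_congr rfl fun m _ => ?_
  rw [hstar]
  simp only [hankel, Matrix.of_apply, Function.Involutive.coe_toPerm, Matrix.submatrix_apply, id]
  congr 2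
  ext i
  simp only [Pi.sub_apply, Pi.neg_apply, MultiIndex.toInt_rev]
  ring

lemma toeplitzOn_one : ToeplitzOn 0 (1 : Matrix (MultiIndex n) (MultiIndex n) ℂ) 1 := by
  intro l h _
  have h1 := coeff_mFourier (k := k) 0 (l.toInt - h.toInt)
  rw [mFourier_zero] at h1
  rw [h1, Matrix.one_apply]
  simp [sub_eq_zero, MultiIndex.toInt_injective.eq_iff]

lemma toeplitzOn_hankel_pow {p : C(UnitAddTorus (Fin k), ℂ)} (hp : p ∈ trigPoly k)
    (hreal : ∀ j, (coeff p j).im = 0) {D₀ : ℕ} (hD₀ : ∀ j, coeff p j ≠ 0 → ∀ i, |j i| ≤ D₀)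
    (r : ℕ) : ToeplitzOn (2 * r * D₀) (hankel (coeff p) n ^ (2 * r)) ((star p * p) ^ r) := by
  induction r with
  | zero => simpa using toeplitzOn_one
  | succ r ih =>
    have h := (ih.hankel_mul hp hD₀).hankel_mul hp hreal hD₀
    convert h using 1
    · ring
    · rw [← pow_succ', ← pow_succ']
      rfl
    · rw [pow_succ', mul_assoc]

lemma hankelOn_hankel_pow {p : C(UnitAddTorus (Fin k), ℂ)} (hp : p ∈ trigPoly k)
    (hreal : ∀ j, (coeff p j).im = 0) {D₀ : ℕ} (hD₀ : ∀ j, coeff p j ≠ 0 → ∀ i, |j i| ≤ D₀)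
    (r : ℕ) : HankelOn (2 * r * D₀ + D₀) (hankel (coeff p) n ^ (2 * r + 1))
      (p * (star p * p) ^ r) := by
  rw [pow_succ']
  exact (toeplitzOn_hankel_pow hp hreal hD₀ r).hankel_mul hp hD₀

lemma sum_norm_pow_apply_le {ι : Type*} [Fintype ι] [DecidableEq ι] {A : Matrix ι ι ℂ} {K : ℝ}
    (hK : 0 ≤ K) (hA : ∀ l, ∑ h, ‖A l h‖ ≤ K) (m : ℕ) (l : ι) :
    ∑ h, ‖(A ^ m) l h‖ ≤ K ^ m := by
  induction m generalizing l with
  | zero => simp [Matrix.one_apply, apply_ite]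
  | succ m ih =>
    rw [pow_succ']
    calc ∑ h, ‖(A * A ^ m) l h‖ ≤ ∑ h, ∑ j, ‖A l j‖ * ‖(A ^ m) j h‖ := by
          refine Finset.sum_le_sum fun h _ => ?_
          rw [Matrix.mul_apply]
          exact (norm_sum_le _ _).trans_eq (by simp)
      _ = ∑ j, ‖A l j‖ * ∑ h, ‖(A ^ m) j h‖ := by
          rw [Finset.sum_comm]
          simp_rw [Finset.mul_sum]
      _ ≤ ∑ j, ‖A l j‖ * K ^ m :=
          Finset.sum_le_sum fun j _ => mul_le_mul_of_nonneg_left (ih j) (norm_nonneg _)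
      _ = (∑ j, ‖A l j‖) * K ^ m := by rw [Finset.sum_mul]
      _ ≤ K ^ (m + 1) := by
          rw [pow_succ']
          exact mul_le_mul_of_nonneg_right (hA l) (by positivity)

lemma norm_hankel_pow_apply_le {p : C(UnitAddTorus (Fin k), ℂ)} (hp : p ∈ trigPoly k) (m : ℕ)
    (l h : MultiIndex n) :
    ‖(hankel (coeff p) n ^ m) l h‖ ≤ (∑' j, ‖coeff p j‖) ^ m := by
  have hs : Summable fun j => ‖coeff p j‖ :=
    summable_of_hasFiniteSupport ((finite_support_coeff hp).subset fun j hj h0 =>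
      hj (by simp only [h0, norm_zero]))
  refine le_trans ?_ (sum_norm_pow_apply_le (A := hankel (coeff p) n)
    (tsum_nonneg fun j => norm_nonneg _) (fun l => ?_) m l)
  · exact Finset.single_le_sum (f := fun h => ‖(hankel (coeff p) n ^ m) l h‖)
      (fun _ _ => norm_nonneg _) (Finset.mem_univ h)
  · have hinj : Function.Injective fun m : MultiIndex n => l.rev.toInt - m.toInt :=
      sub_right_injective.comp MultiIndex.toInt_injective
    rw [← tsum_fintype (L := .unconditional _)]
    exact tsum_comp_le_tsum_of_inj hs (fun _ => norm_nonneg _) hinj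

/-! ### Counting indices near the boundary -/

lemma tendsto_apply_atTop (i : Fin k) :
    Tendsto (fun n : Fin k → ℕ => (n i : ℝ)) atTop atTop :=
  tendsto_natCast_atTop_atTop.comp <| tendsto_atTop.mpr fun b =>
    (eventually_ge_atTop (fun _ => b)).mono fun _ hn => hn i

lemma tendsto_prod_atTop (hk : 0 < k) :
    Tendsto (fun n : Fin k → ℕ => ((∏ i, n i : ℕ) : ℝ)) atTop atTop := by
  refine tendsto_atTop_mono' _ ?_ (tendsto_apply_atTop ⟨0, hk⟩)
  filter_upwards [eventually_ge_atTop (fun _ => 1)] with n hn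
  exact_mod_cast Nat.le_of_dvd (Finset.prod_pos fun i _ => hn i)
    (Finset.dvd_prod_of_mem n (Finset.mem_univ _))

open Classical in
/-- The truncated subtraction is intended: the interior is empty once some `n i ≤ 2 * D`. -/
lemma card_isInterior (D : ℕ) (n : Fin k → ℕ) :
    (Finset.univ.filter fun l : MultiIndex n => l.IsInterior D).card = ∏ i, (n i - 2 * D) := by
  have h1 : (Finset.univ.filter fun l : MultiIndex n => l.IsInterior D) =
      Fintype.piFinset fun i => Finset.univ.filter fun x : Fin (n i) => D ≤ x ∧ x + D < n i := by
    ext l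
    rw [Finset.mem_filter, Fintype.mem_piFinset]
    simp only [Finset.mem_univ, true_and, Finset.mem_filter]
    rfl
  rw [h1, Fintype.card_piFinset]
  refine Finset.prod_congr rfl fun i _ => ?_
  rw [← Finset.card_map Fin.valEmbedding, show n i - 2 * D = (n i - D) - D by omega,
    ← Nat.card_Ico]
  congr 1
  ext x
  simp only [Finset.mem_map, Finset.mem_filter, Finset.mem_univ, true_and, Fin.valEmbedding_apply,
    Finset.mem_Ico]
  constructor
  · rintro ⟨y, hy, rfl⟩
    omega
  · intro hx
    exact ⟨⟨x, by omega⟩, ⟨hx.1, by simp only; omega⟩, rfl⟩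

open Classical in
lemma tendsto_card_not_isInterior_div (D : ℕ) :
    Tendsto (fun n : Fin k → ℕ =>
      ((Finset.univ.filter fun l : MultiIndex n => ¬ l.IsInterior D).card : ℝ) /
        ((∏ i, n i : ℕ) : ℝ)) atTop (𝓝 0) := by
  have h1 : ∀ i, Tendsto (fun n : Fin k → ℕ => ((n i - 2 * D : ℕ) : ℝ) / (n i : ℝ)) atTop
      (𝓝 1) := fun i => by
    have h2 : Tendsto (fun n : Fin k → ℕ => 1 - (2 * D : ℝ) / (n i : ℝ)) atTop (𝓝 (1 - 0)) :=
      tendsto_const_nhds.sub ((tendsto_apply_atTop i).const_div_atTop _)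
    rw [sub_zero] at h2
    refine h2.congr' ?_
    filter_upwards [eventually_ge_atTop (fun _ => 2 * D + 1)] with n hn
    have h3 : 2 * D + 1 ≤ n i := hn i
    rw [Nat.cast_sub (by omega), sub_div, div_self (by norm_cast; omega)]
    push_cast
    rfl
  have h2 := tendsto_finsetProd Finset.univ fun i (_ : i ∈ Finset.univ) => h1 i
  have h3 := (tendsto_const_nhds (x := (1 : ℝ))).sub h2
  simp only [Finset.prod_const_one, sub_self] at h3
  refine h3.congr' ?_
  filter_upwards [eventually_ge_atTop (fun _ => 1)] with n hn
  have hN : ((∏ i, n i : ℕ) : ℝ) ≠ 0 := by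
    exact_mod_cast (Finset.prod_pos fun i _ => hn i).ne'
  have h4 := Finset.card_filter_add_card_filter_not (s := (Finset.univ : Finset (MultiIndex n)))
    (fun l => l.IsInterior D)
  rw [card_isInterior, Finset.card_univ, Fintype.card_pi] at h4
  simp only [Fintype.card_fin] at h4
  rw [Finset.prod_div_distrib, eq_div_iff hN, ← h4]
  have h5 : (∏ i, ((n i : ℕ) : ℝ)) ≠ 0 := by exact_mod_cast hN
  have h6 := congrArg (Nat.cast : ℕ → ℝ) h4
  push_cast at h6 ⊢
  rw [h6]
  field_simp
  linarith

/-! ### Traces of exponentials and their perturbation -/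

section Exponential

variable {ι : Type*} [Fintype ι] [DecidableEq ι]

lemma trace_pow_eq_sum_eigenvalues {A : Matrix ι ι ℂ} (hA : A.IsHermitian) (m : ℕ) :
    (A ^ m).trace = ∑ i, (hA.eigenvalues i : ℂ) ^ m := by
  conv_lhs => rw [hA.spectral_theorem, ← map_pow, Unitary.conjStarAlgAut_apply,
    Matrix.trace_mul_comm, ← mul_assoc]
  simp [Matrix.diagonal_pow, Matrix.trace_diagonal]

lemma trace_exp_smul_eq_sum_eigenvalues {A : Matrix ι ι ℂ} (hA : A.IsHermitian) (z : ℂ) :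
    (NormedSpace.exp (z • A)).trace = ∑ i, Complex.exp (z * hA.eigenvalues i) := by
  have hU : IsUnit (hA.eigenvectorUnitary : Matrix ι ι ℂ) :=
    ⟨Unitary.toUnits hA.eigenvectorUnitary, rfl⟩
  have hinv : star (hA.eigenvectorUnitary : Matrix ι ι ℂ) =
      (hA.eigenvectorUnitary : Matrix ι ι ℂ)⁻¹ :=
    (Matrix.inv_eq_left_inv (Unitary.coe_star_mul_self hA.eigenvectorUnitary)).symm
  conv_lhs => rw [hA.spectral_theorem, ← map_smul, Unitary.conjStarAlgAut_apply, hinv,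
    Matrix.exp_conj _ _ hU, Matrix.trace_mul_comm, ← mul_assoc,
    Matrix.nonsing_inv_mul _ ((Matrix.isUnit_iff_isUnit_det _).mp hU), one_mul,
    ← Matrix.diagonal_smul, Matrix.exp_diagonal, Matrix.trace_diagonal]
  refine Finset.sum_congr rfl fun i _ => ?_
  rw [Pi.coe_exp, ← Complex.exp_eq_exp_ℂ]
  simp

open scoped Matrix.Norms.L2Operator

lemma norm_exp_le_one_of_isHermitian {A : Matrix ι ι ℂ} (hA : A.IsHermitian) (s : ℝ) :
    ‖NormedSpace.exp ((Complex.I * s) • A)‖ ≤ 1 := by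
  have hsa : IsSelfAdjoint (s • A) := by
    rw [IsSelfAdjoint, star_smul, Matrix.star_eq_conjTranspose, hA.eq]
    simp
  have h := selfAdjoint.expUnitary_coe (⟨s • A, hsa⟩ : selfAdjoint (Matrix ι ι ℂ))
  have h2 : Complex.I • (s • A) = (Complex.I * s) • A := by
    rw [mul_smul]
    rfl
  rw [h2] at h
  rw [← h]
  rcases subsingleton_or_nontrivial (Matrix ι ι ℂ) with hs | hs
  · exact (norm_eq_zero.mpr (Subsingleton.elim _ _)).trans_le zero_le_one
  · exact (CStarRing.norm_coe_unitary _).le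

/-- Duhamel's formula, as a bound: `s ↦ tr (e^{istA} e^{i(1-s)tB})` runs from `tr e^{itB}` to
`tr e^{itA}` with derivative `it tr (Z (A - B))` for a contraction `Z` depending on `s`. -/
lemma norm_trace_exp_sub_le {A B : Matrix ι ι ℂ} (hA : A.IsHermitian) (hB : B.IsHermitian)
    {C : ℝ} (hC : ∀ Z : Matrix ι ι ℂ, ‖Z‖ ≤ 1 → ‖(Z * (A - B)).trace‖ ≤ C) (t : ℝ) :
    ‖(NormedSpace.exp ((Complex.I * t) • A)).trace - (NormedSpace.exp ((Complex.I * t) • B)).trace‖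
      ≤ |t| * C := by
  set X := (Complex.I * t) • A with hX
  set Y := (Complex.I * t) • B with hY
  let τ : Matrix ι ι ℂ →L[ℂ] ℂ := (Matrix.traceLinearMap ι ℂ ℂ).toContinuousLinearMap
  have hτ : ∀ M, τ M = M.trace := fun M => rfl
  have haux : ∀ E F : Matrix ι ι ℂ, (Complex.I * t) * τ (F * E * (A - B)) =
      τ (E * X * F + E * (-1 : ℂ) • (Y * F)) := fun E F => by
    -- cyclicity of the trace brings both exponentials to the left
    have h1 : ∀ M : Matrix ι ι ℂ, (E * M * F).trace = (F * E * M).trace := fun M => by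
      rw [Matrix.trace_mul_comm, mul_assoc]
    rw [neg_smul, one_smul, mul_neg, ← sub_eq_add_neg, map_sub, mul_sub, map_sub, hτ, hτ, hτ, hτ,
      ← mul_assoc E Y, h1, h1, hX, hY]
    simp only [Matrix.mul_smul, Matrix.trace_smul, smul_eq_mul, mul_sub]
  have hderiv : ∀ s : ℝ, HasDerivAt
      (fun s : ℝ => τ (NormedSpace.exp ((s : ℂ) • X) * NormedSpace.exp ((1 - (s : ℂ)) • Y)))
      ((Complex.I * t) * τ (NormedSpace.exp ((1 - (s : ℂ)) • Y) * NormedSpace.exp ((s : ℂ) • X)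
        * (A - B))) s := fun s => by
    have h1 := hasDerivAt_exp_smul_const (𝕂 := ℂ) X (s : ℂ)
    have h2 := (hasDerivAt_exp_smul_const' (𝕂 := ℂ) Y (1 - (s : ℂ))).scomp (s : ℂ)
      ((hasDerivAt_id (s : ℂ)).const_sub 1)
    have h3 := (τ.hasFDerivAt.comp_hasDerivAt (s : ℂ) (h1.mul h2)).comp_ofReal
    exact h3.congr_deriv (haux _ _).symm
  have hmv := Convex.norm_image_sub_le_of_norm_hasDerivWithin_le (C := |t| * C)
    (fun s _ => (hderiv s).hasDerivWithinAt) (fun s _ => ?_) (convex_Icc (0 : ℝ) 1)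
    (Set.left_mem_Icc.mpr zero_le_one) (Set.right_mem_Icc.mpr zero_le_one)
  · simpa [hτ] using hmv
  · rw [norm_mul, norm_mul, Complex.norm_I, one_mul, Complex.norm_real, Real.norm_eq_abs, hτ]
    refine mul_le_mul_of_nonneg_left (hC _ ?_) (abs_nonneg t)
    refine (norm_mul_le _ _).trans (mul_le_one₀ ?_ (norm_nonneg _) ?_)
    · have := norm_exp_le_one_of_isHermitian hB ((1 - s) * t)
      rwa [show ((Complex.I * ((1 - s) * t : ℝ)) • B : Matrix ι ι ℂ) = (1 - (s : ℂ)) • Y by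
        rw [hY, smul_smul]; congr 1; push_cast; ring] at this
    · have := norm_exp_le_one_of_isHermitian hA (s * t)
      rwa [show ((Complex.I * (s * t : ℝ)) • A : Matrix ι ι ℂ) = (s : ℂ) • X by
        rw [hX, smul_smul]; congr 1; push_cast; ring] at this

lemma norm_sum_mul_mul_le (Z : Matrix ι ι ℂ) (hZ : ‖Z‖ ≤ 1) (v w : ι → ℂ)
    (hv : ∀ i, ‖v i‖ = 1) (hw : ∀ i, ‖w i‖ = 1) :
    ‖∑ h, ∑ l, v h * Z h l * w l‖ ≤ Fintype.card ι := by
  have hnorm : ∀ u : ι → ℂ, (∀ i, ‖u i‖ = 1) → ‖WithLp.toLp 2 u‖ = √(Fintype.card ι) := by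
    intro u hu
    simp [EuclideanSpace.norm_eq, hu]
  have h1 : ∑ h, ∑ l, v h * Z h l * w l =
      inner ℂ (WithLp.toLp 2 fun h => conj (v h)) (WithLp.toLp 2 (Z.mulVec w)) := by
    simp [PiLp.inner_apply, Matrix.mulVec, dotProduct, Finset.mul_sum, mul_comm,
      mul_left_comm]
  rw [h1]
  refine (norm_inner_le_norm _ _).trans ?_
  have h2 : ‖WithLp.toLp 2 (Z.mulVec w)‖ ≤ ‖Z‖ * ‖WithLp.toLp 2 w‖ :=
    Z.l2_opNorm_mulVec (WithLp.toLp 2 w)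
  rw [hnorm _ (by simpa using hv)]
  rw [hnorm w hw] at h2
  calc √(Fintype.card ι) * ‖WithLp.toLp 2 (Z.mulVec w)‖
      ≤ √(Fintype.card ι) * (1 * √(Fintype.card ι)) :=
        mul_le_mul_of_nonneg_left (h2.trans (mul_le_mul_of_nonneg_right hZ (Real.sqrt_nonneg _)))
          (Real.sqrt_nonneg _)
    _ = Fintype.card ι := by rw [one_mul, Real.mul_self_sqrt (Nat.cast_nonneg _)]

/-- The normalised trace norm of a Hankel matrix is at most the `L¹`-norm of its symbol, in the
dual form that needs no singular values: the matrix is an average, with weight `g(x)`, of rank one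
matrices built from vectors with unimodular entries. -/
lemma norm_trace_mul_hankel_le {g : UnitAddTorus (Fin k) → ℂ} (hg : Integrable g)
    (Z : Matrix (MultiIndex n) (MultiIndex n) ℂ) (hZ : ‖Z‖ ≤ 1) :
    ‖(Z * hankel (coeff g) n).trace‖ ≤ (∏ i, n i : ℕ) * ∫ x, ‖g x‖ := by
  have h1 : (Z * hankel (coeff g) n).trace =
      ∫ x, (∑ h : MultiIndex n, ∑ l : MultiIndex n,
        conj (mFourier h.toInt x) * Z h l * mFourier l.rev.toInt x) * g x := by
    simp_rw [Finset.sum_mul]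
    have hint : ∀ h l : MultiIndex n, Integrable fun x =>
        conj (mFourier h.toInt x) * Z h l * mFourier l.rev.toInt x * g x := fun h l => by
      refine ((integrable_mFourier_mul hg (l.rev.toInt - h.toInt)).const_mul (Z h l)).congr
        (.of_forall fun x => ?_)
      simp only [mFourier_sub]
      ring
    rw [integral_finsetSum _ fun h _ => integrable_finsetSum _ fun l _ => hint h l]
    refine Finset.sum_congr rfl fun h _ => ?_
    rw [integral_finsetSum _ fun l _ => hint h l, Matrix.diag_apply, Matrix.mul_apply]
    refine Finset.sum_congr rfl fun l _ => ?_
    simp only [hankel, Matrix.of_apply, coeff]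
    rw [← integral_const_mul]
    refine integral_congr_ae (.of_forall fun x => ?_)
    simp only [mFourier_sub]
    ring
  rw [h1, ← integral_const_mul]
  refine norm_integral_le_of_norm_le (hg.norm.const_mul _) (.of_forall fun x => ?_)
  rw [norm_mul]
  refine mul_le_mul_of_nonneg_right ?_ (norm_nonneg _)
  have := norm_sum_mul_mul_le Z hZ (fun h : MultiIndex n => conj (mFourier h.toInt x))
    (fun l : MultiIndex n => mFourier l.rev.toInt x)
    (fun _ => by rw [RCLike.norm_conj, norm_mFourier_apply]) (fun _ => norm_mFourier_apply _ _)
  simpa [Fintype.card_pi] using this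

lemma norm_trace_exp_hankel_sub_le {g p : UnitAddTorus (Fin k) → ℂ} (hg : Integrable g)
    (hp : Integrable p) (hgr : ∀ j, (coeff g j).im = 0) (hpr : ∀ j, (coeff p j).im = 0)
    (n : Fin k → ℕ) (t : ℝ) :
    ‖(NormedSpace.exp ((Complex.I * t) • hankel (coeff g) n)).trace -
      (NormedSpace.exp ((Complex.I * t) • hankel (coeff p) n)).trace‖
      ≤ |t| * ((∏ i, n i : ℕ) * ∫ x, ‖g x - p x‖) := by
  refine norm_trace_exp_sub_le (hankel_isHermitian hgr n) (hankel_isHermitian hpr n)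
    (fun Z hZ => ?_) t
  have : hankel (coeff g) n - hankel (coeff p) n = hankel (coeff (g - p)) n := by
    ext l h
    simp [hankel, coeff_sub hg hp]
  rw [this]
  exact norm_trace_mul_hankel_le (hg.sub hp) Z hZ

end Exponential

/-! ### Moments for trigonometric polynomials -/

lemma exists_bound_support_coeff {p : C(UnitAddTorus (Fin k), ℂ)} (hp : p ∈ trigPoly k) :
    ∃ D₀ : ℕ, ∀ j, coeff p j ≠ 0 → ∀ i, |j i| ≤ D₀ := by
  let S := (finite_support_coeff hp).toFinset
  refine ⟨∑ j ∈ S, ∑ i, (j i).natAbs, fun j hj i => ?_⟩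
  have hjS : j ∈ S := by simpa [S] using hj
  have h1 : (j i).natAbs ≤ ∑ i, (j i).natAbs :=
    Finset.single_le_sum (f := fun i => (j i).natAbs) (fun _ _ => Nat.zero_le _)
      (Finset.mem_univ i)
  have h2 : ∑ i, (j i).natAbs ≤ ∑ j ∈ S, ∑ i, (j i).natAbs :=
    Finset.single_le_sum (f := fun j : Fin k → ℤ => ∑ i, (j i).natAbs)
      (fun _ _ => Nat.zero_le _) hjS
  rw [Int.abs_eq_natAbs]
  exact_mod_cast h1.trans h2

/-- A quantity that is bounded up to a bounded contribution of each index near the boundary is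
negligible against the number of all indices. -/
lemma tendsto_inv_mul_of_le_boundary {a : (Fin k → ℕ) → ℂ} {c C : ℝ} {D : ℕ} (hk : 0 < k)
    (ha : ∀ n : Fin k → ℕ, (∀ i, 1 ≤ n i) → ‖a n‖ ≤ c +
      (Nat.card {l : MultiIndex n // ¬ l.IsInterior D} : ℝ) * C) :
    Tendsto (fun n : Fin k → ℕ => ((∏ i, n i : ℕ) : ℂ)⁻¹ * a n) atTop (𝓝 0) := by
  classical
  have h1 : Tendsto (fun n : Fin k → ℕ => c / ((∏ i, n i : ℕ) : ℝ) +
      ((Finset.univ.filter fun l : MultiIndex n => ¬ l.IsInterior D).card : ℝ) /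
        ((∏ i, n i : ℕ) : ℝ) * C) atTop (𝓝 (0 + 0 * C)) :=
    ((tendsto_prod_atTop hk).const_div_atTop c).add
      ((tendsto_card_not_isInterior_div D).mul_const C)
  rw [zero_mul, add_zero] at h1
  refine squeeze_zero_norm' ?_ h1
  filter_upwards [eventually_ge_atTop (fun _ => 1)] with n hn
  have h2 := ha n hn
  rw [Nat.card_eq_fintype_card, Fintype.card_subtype] at h2
  rw [norm_mul, norm_inv, Complex.norm_natCast, div_mul_eq_mul_div, ← add_div, div_eq_inv_mul]
  refine mul_le_mul_of_nonneg_left ?_ (by positivity)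
  convert h2

lemma norm_sum_le_of_isInterior {D : ℕ} {C : ℝ} {F G : MultiIndex n → ℂ}
    (hint : ∀ l, l.IsInterior D → F l = G l) (hF : ∀ l, ‖F l - G l‖ ≤ C) :
    ‖∑ l, F l - ∑ l, G l‖ ≤ (Nat.card {l : MultiIndex n // ¬ l.IsInterior D} : ℝ) * C := by
  classical
  rw [Nat.card_eq_fintype_card, Fintype.card_subtype, ← Finset.sum_sub_distrib]
  have : ∑ l, (F l - G l) = ∑ l ∈ Finset.univ.filter fun l : MultiIndex n => ¬ l.IsInterior D,
      (F l - G l) := by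
    refine (Finset.sum_subset (Finset.filter_subset _ _) fun l _ hl => ?_).symm
    rw [hint l (by simpa using hl), sub_self]
  rw [this, ← nsmul_eq_mul]
  exact (norm_sum_le_of_le _ fun l _ => hF l).trans_eq (Finset.sum_const _)

/-- The limit moments: even powers of the Hankel matrix are Toeplitz away from the boundary, odd
ones are Hankel away from the boundary and have boundedly many nonnegligible diagonal entries. -/
lemma tendsto_trace_hankel_pow (hk : 0 < k) {p : C(UnitAddTorus (Fin k), ℂ)}
    (hp : p ∈ trigPoly k) (hreal : ∀ j, (coeff p j).im = 0) (m : ℕ) :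
    Tendsto (fun n : Fin k → ℕ => ((∏ i, n i : ℕ) : ℂ)⁻¹ * (hankel (coeff p) n ^ m).trace) atTop
      (𝓝 (∫ x, ((‖p x‖ : ℂ) ^ m + (-(‖p x‖ : ℂ)) ^ m) / 2)) := by
  obtain ⟨D₀, hD₀⟩ := exists_bound_support_coeff hp
  set K := ∑' j, ‖coeff p j‖
  rcases Nat.even_or_odd' m with ⟨r, rfl | rfl⟩
  · set u := (star p * p) ^ r with hu
    have hlim : ∫ x, ((‖p x‖ : ℂ) ^ (2 * r) + (-(‖p x‖ : ℂ)) ^ (2 * r)) / 2 = coeff u 0 := by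
      rw [coeff]
      refine integral_congr_ae (.of_forall fun x => ?_)
      have : conj (p x) * p x = (‖p x‖ : ℂ) ^ 2 := by
        rw [mul_comm, Complex.mul_conj, Complex.normSq_eq_norm_sq]
        push_cast
        rfl
      simp [hu, mFourier_zero, pow_mul, this]
    rw [hlim]
    have h0 := tendsto_inv_mul_of_le_boundary (c := 0) (C := K ^ (2 * r) + ‖coeff u 0‖)
      (D := 2 * r * D₀)
      (a := fun n : Fin k → ℕ => (hankel (coeff p) n ^ (2 * r)).trace -
        ∑ _ : MultiIndex n, coeff u 0) hk fun n _ => by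
        rw [zero_add]
        refine norm_sum_le_of_isInterior (fun l hl => ?_) fun l => ?_
        · rw [Matrix.diag_apply, toeplitzOn_hankel_pow hp hreal hD₀ r l l hl, sub_self]
        · exact (norm_sub_le _ _).trans
            (add_le_add (norm_hankel_pow_apply_le hp _ _ _) le_rfl)
    have h1 := h0.add_const (coeff u 0)
    rw [zero_add] at h1
    refine h1.congr' ?_
    filter_upwards [eventually_ge_atTop (fun _ => 1)] with n hn
    have hN : ((∏ i, n i : ℕ) : ℂ) ≠ 0 := by
      exact_mod_cast (Finset.prod_pos fun i _ => hn i).ne'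
    rw [Finset.sum_const, Finset.card_univ, Fintype.card_pi, nsmul_eq_mul]
    simp only [Fintype.card_fin]
    rw [mul_sub, inv_mul_cancel_left₀ hN, sub_add_cancel]
  · set u := p * (star p * p) ^ r with hu
    have hlim : ∫ x, ((‖p x‖ : ℂ) ^ (2 * r + 1) + (-(‖p x‖ : ℂ)) ^ (2 * r + 1)) / 2 = 0 := by
      simp [Odd.neg_pow ⟨r, rfl⟩]
    rw [hlim]
    have hum : u ∈ trigPoly k := by
      refine mul_mem_trigPoly hp ?_
      clear hlim hu u
      induction r with
      | zero => exact one_mem_trigPoly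
      | succ r ih =>
        rw [pow_succ]
        exact mul_mem_trigPoly ih (mul_mem_trigPoly (star_mem_trigPoly hp) hp)
    have hs : Summable fun j => ‖coeff u j‖ :=
      summable_of_hasFiniteSupport ((finite_support_coeff hum).subset fun j hj h0 =>
        hj (by simp only [h0, norm_zero]))
    have hle : ∀ j, ‖coeff u j‖ ≤ ∑' j, ‖coeff u j‖ := fun j =>
      hs.le_tsum j fun _ _ => norm_nonneg _
    refine tendsto_inv_mul_of_le_boundary (c := ∑' j, ‖coeff u j‖)
      (C := K ^ (2 * r + 1) + ∑' j, ‖coeff u j‖) (D := 2 * r * D₀ + D₀) hk fun n _ => ?_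
    have h1 : ‖(hankel (coeff p) n ^ (2 * r + 1)).trace -
        ∑ l : MultiIndex n, coeff u (l.rev.toInt - l.toInt)‖ ≤
        (Nat.card {l : MultiIndex n // ¬ l.IsInterior (2 * r * D₀ + D₀)} : ℝ) *
          (K ^ (2 * r + 1) + ∑' j, ‖coeff u j‖) :=
      norm_sum_le_of_isInterior
        (fun l hl => by rw [Matrix.diag_apply, hankelOn_hankel_pow hp hreal hD₀ r l l hl])
        fun l => (norm_sub_le _ _).trans (add_le_add (norm_hankel_pow_apply_le hp _ _ _) (hle _))
    -- each Fourier coefficient of `u` occurs at most once on the diagonal of its Hankel matrix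
    have hinj : Function.Injective fun l : MultiIndex n => l.rev.toInt - l.toInt := by
      intro l h hlh
      refine MultiIndex.toInt_injective (funext fun i => ?_)
      have := congrFun hlh i
      simp only [Pi.sub_apply, MultiIndex.toInt_rev] at this
      omega
    have h2 : ‖∑ l : MultiIndex n, coeff u (l.rev.toInt - l.toInt)‖ ≤ ∑' j, ‖coeff u j‖ := by
      refine (norm_sum_le _ _).trans ?_
      rw [← tsum_fintype (L := .unconditional _)]
      exact tsum_comp_le_tsum_of_inj hs (fun _ => norm_nonneg _) hinj
    calc _ ≤ _ := norm_le_norm_add_norm_sub' _ (∑ l : MultiIndex n, coeff u (l.rev.toInt - l.toInt))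
      _ ≤ _ := add_le_add h2 h1

/-- The power series of the cosine, with the even powers written as averages so that its terms
match the limit moments of all orders. -/
lemma hasSum_cos (t x : ℝ) :
    HasSum (fun m : ℕ => (Complex.I * t) ^ m / (m.factorial : ℂ) *
      (((x : ℂ) ^ m + (-(x : ℂ)) ^ m) / 2)) (Complex.cos (t * x)) := by
  have h1 : ∀ z : ℂ, HasSum (fun m : ℕ => z ^ m / (m.factorial : ℂ)) (Complex.exp z) := fun z => by
    rw [Complex.exp_eq_exp_ℂ]
    exact NormedSpace.expSeries_div_hasSum_exp z
  have h2 := ((h1 (Complex.I * t * x)).add (h1 (Complex.I * t * -x))).div_const 2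
  have h3 : Complex.cos (t * x) =
      (Complex.exp (Complex.I * t * x) + Complex.exp (Complex.I * t * -x)) / 2 := by
    rw [Complex.cos]
    ring_nf
  rw [h3]
  refine h2.congr_fun fun m => ?_
  rw [mul_pow (Complex.I * t) (x : ℂ), mul_pow (Complex.I * t) (-(x : ℂ))]
  ring

lemma tendsto_trace_exp_hankel_of_trigPoly (hk : 0 < k) {p : C(UnitAddTorus (Fin k), ℂ)}
    (hp : p ∈ trigPoly k) (hreal : ∀ j, (coeff p j).im = 0) (t : ℝ) :
    Tendsto (fun n : Fin k → ℕ => ((∏ i, n i : ℕ) : ℂ)⁻¹ *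
      (NormedSpace.exp ((Complex.I * t) • hankel (coeff p) n)).trace) atTop
      (𝓝 (∫ x, Complex.cos (t * ‖p x‖))) := by
  set K := ∑' j, ‖coeff p j‖
  have hsum : ∀ n : Fin k → ℕ, HasSum (fun m : ℕ => (Complex.I * t) ^ m / (m.factorial : ℂ) *
      (((∏ i, n i : ℕ) : ℂ)⁻¹ * (hankel (coeff p) n ^ m).trace))
      (((∏ i, n i : ℕ) : ℂ)⁻¹ *
        (NormedSpace.exp ((Complex.I * t) • hankel (coeff p) n)).trace) := by
    intro n
    have hA := hankel_isHermitian hreal n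
    rw [trace_exp_smul_eq_sum_eigenvalues hA]
    have h1 : HasSum (fun m : ℕ => ∑ i, (Complex.I * t * hA.eigenvalues i) ^ m / (m.factorial : ℂ))
        (∑ i, Complex.exp (Complex.I * t * hA.eigenvalues i)) := hasSum_sum fun i _ => by
      rw [Complex.exp_eq_exp_ℂ]
      exact NormedSpace.expSeries_div_hasSum_exp _
    refine (h1.mul_left (((∏ i, n i : ℕ) : ℂ)⁻¹)).congr_fun fun m => ?_
    rw [trace_pow_eq_sum_eigenvalues hA, mul_left_comm, Finset.mul_sum]
    congr 1
    refine Finset.sum_congr rfl fun i _ => ?_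
    rw [mul_pow (Complex.I * t)]
    ring
  have hexp : ∀ a : ℝ, Summable fun m : ℕ => |t| ^ m / (m.factorial : ℝ) * a ^ m := fun a => by
    refine (Real.summable_pow_div_factorial (|t| * a)).congr fun m => ?_
    rw [mul_pow]
    ring
  have hlim : ∫ x, Complex.cos (t * ‖p x‖) = ∑' m : ℕ, (Complex.I * t) ^ m / (m.factorial : ℂ) *
      ∫ x, ((‖p x‖ : ℂ) ^ m + (-(‖p x‖ : ℂ)) ^ m) / 2 := by
    simp_rw [← integral_const_mul]
    refine (HasSum.tsum_eq (hasSum_integral_of_dominated_convergence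
      (fun m _ => |t| ^ m / (m.factorial : ℝ) * ‖p‖ ^ m) (fun m => ?_) (fun m => ?_) ?_ ?_ ?_)).symm
    · exact Continuous.aestronglyMeasurable (by fun_prop)
    · refine .of_forall fun x => ?_
      rw [norm_mul, norm_div, norm_pow, norm_mul, Complex.norm_I, one_mul, Complex.norm_real,
        Real.norm_eq_abs, Complex.norm_natCast]
      refine mul_le_mul_of_nonneg_left ?_ (by positivity)
      rw [norm_div, Complex.norm_two, div_le_iff₀ two_pos, mul_two]
      refine (norm_add_le _ _).trans ?_
      simp only [norm_pow, norm_neg, Complex.norm_real, norm_norm]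
      have := pow_le_pow_left₀ (norm_nonneg _) (p.norm_coe_le_norm x) m
      exact add_le_add this this
    · exact .of_forall fun _ => hexp _
    · exact integrable_const _
    · exact .of_forall fun x => hasSum_cos t ‖p x‖
  rw [hlim]
  simp_rw [← fun n => (hsum n).tsum_eq]
  refine tendsto_tsum_of_dominated_convergence (hexp K)
    (fun m => (tendsto_trace_hankel_pow hk hp hreal m).const_mul _) ?_
  filter_upwards [eventually_ge_atTop (fun _ => 1)] with n hn m
  rw [norm_mul, norm_div, norm_pow, norm_mul, Complex.norm_I, one_mul, Complex.norm_real,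
    Real.norm_eq_abs, Complex.norm_natCast]
  refine mul_le_mul_of_nonneg_left ?_ (by positivity)
  have hN : (0 : ℝ) < ((∏ i, n i : ℕ) : ℝ) := by
    exact_mod_cast Finset.prod_pos fun i _ => hn i
  rw [norm_mul, norm_inv, Complex.norm_natCast, inv_mul_le_iff₀ hN, ← nsmul_eq_mul]
  refine (norm_sum_le_of_le (n := fun _ => K ^ m) _ fun l _ =>
    norm_hankel_pow_apply_le hp m l l).trans_eq ?_
  rw [Finset.sum_const, Finset.card_univ, Fintype.card_pi]
  simp only [Fintype.card_fin]

/-! ### General symbols -/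

lemma norm_integral_cos_sub_le {g p : UnitAddTorus (Fin k) → ℂ} (hg : Integrable g)
    (hp : Integrable p) (t : ℝ) :
    ‖(∫ x, Complex.cos (t * ‖g x‖)) - ∫ x, Complex.cos (t * ‖p x‖)‖ ≤
      |t| * ∫ x, ‖g x - p x‖ := by
  have hcos : ∀ {h : UnitAddTorus (Fin k) → ℂ}, Integrable h →
      Integrable fun x => Complex.cos (t * ‖h x‖) := fun {h} hh => by
    refine Integrable.of_bound (C := 1)
      ((Complex.continuous_cos.comp (continuous_const.mul
        (Complex.continuous_ofReal.comp continuous_norm))).comp_aestronglyMeasurable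
          hh.aestronglyMeasurable) (.of_forall fun x => ?_)
    rw [← Complex.ofReal_mul, ← Complex.ofReal_cos, Complex.norm_real]
    exact Real.abs_cos_le_one _
  rw [← integral_sub (hcos hg) (hcos hp), ← integral_const_mul]
  refine norm_integral_le_of_norm_le ((hg.sub hp).norm.const_mul _) (.of_forall fun x => ?_)
  rw [← Complex.ofReal_mul, ← Complex.ofReal_mul, ← Complex.ofReal_cos, ← Complex.ofReal_cos,
    ← Complex.ofReal_sub, Complex.norm_real, Real.norm_eq_abs]
  have h1 := Real.lipschitzWith_cos.dist_le_mul (t * ‖g x‖) (t * ‖p x‖)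
  rw [Real.dist_eq, Real.dist_eq, ← mul_sub, abs_mul] at h1
  calc _ ≤ |t| * |‖g x‖ - ‖p x‖| := by simpa using h1
    _ ≤ _ := mul_le_mul_of_nonneg_left (abs_norm_sub_norm_le _ _) (abs_nonneg t)

/-- The `L¹`-approximation step from trigonometric polynomials to integrable symbols. -/
lemma tendsto_trace_exp_hankel (hk : 0 < k) {g : UnitAddTorus (Fin k) → ℂ} (hg : Integrable g)
    (hreal : ∀ j, (coeff g j).im = 0) (t : ℝ) :
    Tendsto (fun n : Fin k → ℕ => ((∏ i, n i : ℕ) : ℂ)⁻¹ *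
      (NormedSpace.exp ((Complex.I * t) • hankel (coeff g) n)).trace) atTop
      (𝓝 (∫ x, Complex.cos (t * ‖g x‖))) := by
  rw [Metric.tendsto_nhds]
  intro ε hε
  have hδ : 0 < ε / (3 * (|t| + 1)) := by positivity
  obtain ⟨p, hp, hpr, hgp⟩ := exists_real_trigPoly hg hreal hδ
  have hpi := integrable_continuousMap p
  have hsmall : |t| * ∫ x, ‖g x - p x‖ < ε / 3 := by
    calc |t| * ∫ x, ‖g x - p x‖ ≤ |t| * (ε / (3 * (|t| + 1))) :=
          mul_le_mul_of_nonneg_left hgp (abs_nonneg t)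
      _ < (|t| + 1) * (ε / (3 * (|t| + 1))) := by
          exact mul_lt_mul_of_pos_right (lt_add_one _) hδ
      _ = ε / 3 := by field_simp
  filter_upwards [Metric.tendsto_nhds.mp (tendsto_trace_exp_hankel_of_trigPoly hk hp hpr t) (ε / 3)
    (by positivity), eventually_ge_atTop (fun _ => 1)] with n hn hn1
  have hN : (0 : ℝ) < ((∏ i, n i : ℕ) : ℝ) := by
    exact_mod_cast Finset.prod_pos fun i _ => hn1 i
  have h1 := norm_trace_exp_hankel_sub_le hg hpi hreal hpr n t
  have h2 := norm_integral_cos_sub_le hpi hg t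
  simp_rw [norm_sub_rev (p _)] at h2
  have h3 : dist (((∏ i, n i : ℕ) : ℂ)⁻¹ *
      (NormedSpace.exp ((Complex.I * t) • hankel (coeff g) n)).trace) (((∏ i, n i : ℕ) : ℂ)⁻¹ *
      (NormedSpace.exp ((Complex.I * t) • hankel (coeff p) n)).trace) ≤
      |t| * ∫ x, ‖g x - p x‖ := by
    rw [dist_eq_norm, ← mul_sub, norm_mul, norm_inv, Complex.norm_natCast, inv_mul_le_iff₀ hN]
    exact h1.trans_eq (by ring)
  rw [← dist_eq_norm] at h2
  calc _ ≤ _ := dist_triangle4 _ (((∏ i, n i : ℕ) : ℂ)⁻¹ *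
        (NormedSpace.exp ((Complex.I * t) • hankel (coeff p) n)).trace)
        (∫ x, Complex.cos (t * ‖p x‖)) _
    _ < ε := by linarith

/-! ### The eigenvalue distribution on the torus -/

/-- Lévy's continuity theorem along a countably generated filter, for measures that are only
eventually probability measures (the counting measure of an empty matrix is zero). -/
lemma tendsto_integral_of_tendsto_charFun {ι : Type*} {L : Filter ι} [L.IsCountablyGenerated]
    {μ : ι → Measure ℝ} {ν : Measure ℝ} [IsProbabilityMeasure ν]
    (hμ : ∀ᶠ i in L, IsProbabilityMeasure (μ i))
    (h : ∀ t, Tendsto (fun i => charFun (μ i) t) L (𝓝 (charFun ν t)))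
    (F : BoundedContinuousFunction ℝ ℂ) :
    Tendsto (fun i => ∫ x, F x ∂μ i) L (𝓝 (∫ x, F x ∂ν)) := by
  classical
  refine tendsto_of_seq_tendsto fun u hu => ?_
  let P : ℕ → ProbabilityMeasure ℝ := fun m =>
    if hm : IsProbabilityMeasure (μ (u m)) then ⟨μ (u m), hm⟩ else ⟨Measure.dirac 0, inferInstance⟩
  have hP : ∀ᶠ m in atTop, (P m : Measure ℝ) = μ (u m) := by
    filter_upwards [hu.eventually hμ] with m hm
    simp [P, hm]
  have h1 : Tendsto P atTop (𝓝 ⟨ν, inferInstance⟩) :=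
    ProbabilityMeasure.tendsto_iff_tendsto_charFun.mpr fun t =>
      ((h t).comp hu).congr' (hP.mono fun m hm => by simp only [Function.comp, hm])
  refine ((ProbabilityMeasure.tendsto_iff_forall_integral_rclike_tendsto ℂ).mp h1 F).congr' ?_
  exact hP.mono fun m hm => by simp only [Function.comp, hm]

/-- The normalised counting measure of a finite family of reals. -/
def empiricalMeasure {ι : Type*} [Fintype ι] (a : ι → ℝ) : Measure ℝ :=
  (Fintype.card ι : ENNReal)⁻¹ • ∑ i, Measure.dirac (a i)

lemma integral_empiricalMeasure {ι : Type*} [Fintype ι] (a : ι → ℝ) (F : ℝ → ℂ) :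
    ∫ x, F x ∂empiricalMeasure a = (Fintype.card ι : ℂ)⁻¹ * ∑ i, F (a i) := by
  rw [empiricalMeasure, integral_smul_measure, integral_finsetSum_measure fun i _ =>
    integrable_dirac (by simp [enorm_lt_top])]
  simp [integral_dirac]

lemma isProbabilityMeasure_empiricalMeasure {ι : Type*} [Fintype ι] [Nonempty ι] (a : ι → ℝ) :
    IsProbabilityMeasure (empiricalMeasure a) := by
  constructor
  simp [empiricalMeasure, ENNReal.inv_mul_cancel]

lemma tendsto_sum_eigenvalues_hankel (hk : 0 < k) {g : UnitAddTorus (Fin k) → ℂ}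
    (hg : Integrable g) (hreal : ∀ j, (coeff g j).im = 0)
    (F : BoundedContinuousFunction ℝ ℂ) :
    Tendsto (fun n : Fin k → ℕ => ((∏ i, n i : ℕ) : ℂ)⁻¹ *
      ∑ i, F ((hankel_isHermitian hreal n).eigenvalues i)) atTop
      (𝓝 (((∫ x, F ‖g x‖) + ∫ x, F (-‖g x‖)) / 2)) := by
  have hcard : ∀ n : Fin k → ℕ, (Fintype.card (MultiIndex n) : ℂ) = ((∏ i, n i : ℕ) : ℂ) :=
    fun n => by rw [Fintype.card_pi]; simp
  have hm1 : AEMeasurable (fun x => ‖g x‖) := hg.aestronglyMeasurable.norm.aemeasurable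
  have hm2 : AEMeasurable (fun x => -‖g x‖) := hm1.neg
  let ν : Measure ℝ := (2 : ENNReal)⁻¹ • (Measure.map (fun x => ‖g x‖) volume +
    Measure.map (fun x => -‖g x‖) volume)
  have hν : IsProbabilityMeasure ν := by
    constructor
    have h1 := (Measure.isProbabilityMeasure_map hm1).measure_univ
    have h2 := (Measure.isProbabilityMeasure_map hm2).measure_univ
    simp only [ν, Measure.smul_apply, Measure.add_apply, h1, h2, smul_eq_mul, one_add_one_eq_two]
    exact ENNReal.inv_mul_cancel two_ne_zero ENNReal.ofNat_ne_top
  have hint : ∀ F : BoundedContinuousFunction ℝ ℂ,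
      ∫ x, F x ∂ν = ((∫ x, F ‖g x‖) + ∫ x, F (-‖g x‖)) / 2 := fun F => by
    have := Measure.isProbabilityMeasure_map hm1
    have := Measure.isProbabilityMeasure_map hm2
    rw [integral_smul_measure, integral_add_measure (F.integrable _) (F.integrable _),
      integral_map hm1 F.continuous.aestronglyMeasurable,
      integral_map hm2 F.continuous.aestronglyMeasurable]
    simp only [ENNReal.toReal_inv, ENNReal.toReal_ofNat, Complex.real_smul]
    push_cast
    ring
  have hmain := tendsto_integral_of_tendsto_charFun (L := atTop)
    (μ := fun n : Fin k → ℕ => empiricalMeasure (hankel_isHermitian hreal n).eigenvalues)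
    (ν := ν) ?_ ?_ F
  · simp_rw [integral_empiricalMeasure, hcard] at hmain
    rwa [hint F] at hmain
  · filter_upwards [eventually_ge_atTop (fun _ => 1)] with n hn
    have : ∀ i, Nonempty (Fin (n i)) := fun i => ⟨⟨0, hn i⟩⟩
    exact isProbabilityMeasure_empiricalMeasure _
  · intro t
    simp_rw [charFun_apply_real, integral_empiricalMeasure, hcard]
    let E : BoundedContinuousFunction ℝ ℂ := BoundedContinuousFunction.ofNormedAddCommGroup
      (fun x : ℝ => Complex.exp (t * x * Complex.I)) (by fun_prop) 1 fun x => by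
        rw [← Complex.ofReal_mul, Complex.norm_exp_ofReal_mul_I]
    have hE : ∫ x : ℝ, Complex.exp (t * x * Complex.I) ∂ν = ∫ x, Complex.cos (t * ‖g x‖) := by
      have hEi : ∀ {h : UnitAddTorus (Fin k) → ℝ}, AEMeasurable h → Integrable fun x => E (h x) :=
        fun {h} hh => Integrable.of_bound
          (E.continuous.comp_aestronglyMeasurable hh.aestronglyMeasurable) ‖E‖
          (.of_forall fun x => E.norm_coe_le_norm _)
      refine (hint E).trans ?_
      rw [← integral_add (hEi hm1) (hEi hm2), ← integral_div]
      refine integral_congr_ae (.of_forall fun x => ?_)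
      simp [E, Complex.cos]
    rw [hE]
    refine (tendsto_trace_exp_hankel hk hg hreal t).congr fun n => ?_
    rw [trace_exp_smul_eq_sum_eigenvalues (hankel_isHermitian hreal n)]
    congr 1
    refine Finset.sum_congr rfl fun i _ => ?_
    congr 1
    ring

lemma tendsto_eigenvalueSum_hankel (hk : 0 < k) {g : UnitAddTorus (Fin k) → ℂ}
    (hg : Integrable g) (hreal : ∀ j, (coeff g j).im = 0) {F : ℂ → ℂ} (hF : Continuous F)
    (hFs : HasCompactSupport F) :
    Tendsto (fun n : Fin k → ℕ => 1 / ((∏ i, n i : ℕ) : ℂ) *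
      eigenvalueSum (hankel (coeff g) n) F) atTop
      (𝓝 (((∫ x, F (‖g x‖ : ℂ)) + ∫ x, F (-(‖g x‖ : ℂ))) / 2)) := by
  obtain ⟨C, hC⟩ := hF.bounded_above_of_compact_support hFs
  have h := tendsto_sum_eigenvalues_hankel hk hg hreal
    (BoundedContinuousFunction.ofNormedAddCommGroup (fun x : ℝ => F x) (by fun_prop) C
      fun x => hC x)
  simp only [BoundedContinuousFunction.coe_ofNormedAddCommGroup, Complex.ofReal_neg] at h
  refine h.congr fun n => ?_
  rw [eigenvalueSum, (hankel_isHermitian hreal n).roots_charpoly_eq_eigenvalues, Multiset.map_map,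
    one_div]
  rfl

/-! ### From angles to the torus -/

lemma measurePreserving_coe_div_two_pi (a : ℝ) :
    MeasurePreserving (fun x : ℝ => ((x / (2 * Real.pi) : ℝ) : UnitAddCircle))
      (volume.restrict (Set.Ioc a (a + 2 * Real.pi)))
      (ENNReal.ofReal (2 * Real.pi) • AddCircle.haarAddCircle) := by
  have hpi := Real.two_pi_pos
  have h1 := AddCircle.measurePreserving_mk 1 (a / (2 * Real.pi))
  rw [AddCircle.volume_eq_smul_haarAddCircle, ENNReal.ofReal_one, one_smul] at h1
  have h2 : MeasurePreserving (fun x : ℝ => (2 * Real.pi)⁻¹ * x) volume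
      (ENNReal.ofReal (2 * Real.pi) • volume) := by
    refine ⟨by fun_prop, ?_⟩
    rw [Real.map_volume_mul_left (inv_pos.mpr hpi).ne', inv_inv, abs_of_pos hpi]
  have h3 := h2.restrict_preimage (s := Set.Ioc (a / (2 * Real.pi)) (a / (2 * Real.pi) + 1))
    measurableSet_Ioc
  have hpre : (fun x : ℝ => (2 * Real.pi)⁻¹ * x) ⁻¹'
      Set.Ioc (a / (2 * Real.pi)) (a / (2 * Real.pi) + 1) = Set.Ioc a (a + 2 * Real.pi) := by
    ext x
    rw [Set.mem_preimage, Set.mem_Ioc, Set.mem_Ioc, inv_mul_eq_div, div_lt_div_iff_of_pos_right hpi,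
      div_add_one hpi.ne', div_le_div_iff_of_pos_right hpi]
  rw [hpre, Measure.restrict_smul] at h3
  convert (h1.smul_measure (ENNReal.ofReal (2 * Real.pi))).comp h3 using 2 with x
  simp [div_eq_inv_mul]

/-- The angle vector `θ` as the point `θ / 2π` of the unit torus. -/
def toTorus (θ : Fin k → ℝ) : UnitAddTorus (Fin k) :=
  fun i => ((θ i / (2 * Real.pi) : ℝ) : UnitAddCircle)

/-- The representative of a point of the torus by angles in `(-π, π]`. -/
def fromTorus (x : UnitAddTorus (Fin k)) : Fin k → ℝ :=
  fun i => 2 * Real.pi * (AddCircle.equivIoc 1 (-(1 / 2)) (x i) : ℝ)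

lemma fromTorus_toTorus (θ : Fin k → ℝ) :
    fromTorus (toTorus θ) = fun i => toIocMod Real.two_pi_pos (-Real.pi) (θ i) := by
  have hpi := Real.two_pi_pos
  ext i
  symm
  change _ = 2 * Real.pi * toIocMod one_pos (-(1 / 2)) (θ i / (2 * Real.pi))
  rw [toIocMod_eq_iff]
  have h1 := toIocMod_mem_Ioc one_pos (-(1 / 2)) (θ i / (2 * Real.pi))
  have h2 := toIocMod_add_toIocDiv_zsmul one_pos (-(1 / 2)) (θ i / (2 * Real.pi))
  refine ⟨⟨by nlinarith [h1.1], by nlinarith [h1.2]⟩,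
    toIocDiv one_pos (-(1 / 2)) (θ i / (2 * Real.pi)), ?_⟩
  rw [eq_div_iff hpi.ne'] at h2
  refine h2.symm.trans ?_
  simp only [zsmul_eq_mul]
  ring

lemma toTorus_add_two_pi (θ : Fin k → ℝ) : toTorus (fun i => θ i + 2 * Real.pi) = toTorus θ := by
  ext i
  simp only [toTorus]
  rw [add_div, div_self Real.two_pi_pos.ne', AddCircle.coe_add_period]

/-- The periodic extension factors through the torus, with no exceptional set. -/
lemma periodicExt_eq (f : (Fin k → ℝ) → ℂ) (θ : Fin k → ℝ) :
    periodicExt f θ = f (fromTorus (toTorus θ)) := by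
  rw [fromTorus_toTorus]
  rfl

lemma measurable_fromTorus : Measurable (fromTorus (k := k)) :=
  measurable_pi_lambda _ fun i => (measurable_subtype_coe.comp
    ((AddCircle.measurableEquivIoc 1 (-(1 / 2))).measurable.comp
      (measurable_pi_apply i))).const_mul _

lemma restrict_Icc_eq_pi (a b : Fin k → ℝ) :
    (volume : Measure (Fin k → ℝ)).restrict (Set.Icc a b) =
      Measure.pi fun i => volume.restrict (Set.Ioc (a i) (b i)) := by
  rw [← Measure.restrict_pi_pi, ← volume_pi]
  refine Measure.restrict_congr_set ?_
  rw [volume_pi]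
  exact Measure.univ_pi_Ioc_ae_eq_Icc.symm

lemma measurePreserving_toTorus (a : Fin k → ℝ) :
    MeasurePreserving toTorus
      (volume.restrict (Set.Icc a fun i => a i + 2 * Real.pi))
      (ENNReal.ofReal (2 * Real.pi) ^ k • volume) := by
  have hfin : IsFiniteMeasure
      (ENNReal.ofReal (2 * Real.pi) • (volume : Measure UnitAddCircle)) :=
    Measure.smul_finite _ ENNReal.ofReal_ne_top
  have h := measurePreserving_pi
    (fun i : Fin k => (volume : Measure ℝ).restrict (Set.Ioc (a i) (a i + 2 * Real.pi)))
    (fun _ => ENNReal.ofReal (2 * Real.pi) • (volume : Measure UnitAddCircle))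
    (fun i => measurePreserving_coe_div_two_pi (a i))
  have hpi : Measure.pi (fun _ : Fin k => ENNReal.ofReal (2 * Real.pi) •
      (volume : Measure UnitAddCircle)) = ENNReal.ofReal (2 * Real.pi) ^ k • volume := by
    refine Measure.pi_eq fun s _ => ?_
    simp [volume_pi, Measure.pi_pi, Finset.prod_mul_distrib]
  rw [hpi] at h
  rw [restrict_Icc_eq_pi]
  exact h

lemma cube_eq : cube k = Set.Icc (fun _ => -Real.pi) fun _ => -Real.pi + 2 * Real.pi := by
  rw [cube]
  congr 1
  ext
  ring

lemma fromTorus_toTorus_ae (k : ℕ) :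
    ∀ᵐ θ ∂(volume : Measure (Fin k → ℝ)).restrict (cube k), fromTorus (toTorus θ) = θ := by
  rw [cube_eq, restrict_Icc_eq_pi, ← Measure.restrict_pi_pi]
  refine (ae_restrict_mem (MeasurableSet.univ_pi fun i => measurableSet_Ioc)).mono fun θ hθ => ?_
  rw [fromTorus_toTorus]
  ext i
  rw [toIocMod_eq_self]
  exact hθ i trivial

lemma measurePreserving_fromTorus :
    MeasurePreserving (fromTorus (k := k)) (ENNReal.ofReal (2 * Real.pi) ^ k • volume)
      (volume.restrict (cube k)) := by
  have h := measurePreserving_toTorus (k := k) fun _ => -Real.pi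
  rw [← cube_eq] at h
  refine ⟨measurable_fromTorus, ?_⟩
  rw [← h.map_eq, Measure.map_map measurable_fromTorus h.measurable]
  have : fromTorus ∘ toTorus =ᵐ[volume.restrict (cube k)] id := fromTorus_toTorus_ae k
  rw [Measure.map_congr this, Measure.map_id]

lemma integrable_comp_fromTorus {f : (Fin k → ℝ) → ℂ} (hf : IntegrableOn f (cube k)) :
    Integrable (f ∘ fromTorus) := by
  have h := measurePreserving_fromTorus.integrable_comp_of_integrable hf
  rwa [integrable_smul_measure (by simp [Real.pi_pos]) (by finiteness)] at h

lemma setIntegral_comp_toTorus (a : Fin k → ℝ) {H : UnitAddTorus (Fin k) → ℂ}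
    (hH : AEStronglyMeasurable H) :
    ∫ θ in Set.Icc a fun i => a i + 2 * Real.pi, H (toTorus θ) =
      (2 * (Real.pi : ℂ)) ^ k * ∫ x, H x := by
  have h := measurePreserving_toTorus a
  have hH' : AEStronglyMeasurable H
      (Measure.map toTorus (volume.restrict (Set.Icc a fun i => a i + 2 * Real.pi))) := by
    rw [h.map_eq]
    exact hH.smul_measure _
  rw [← integral_map h.aemeasurable hH', h.map_eq, integral_smul_measure]
  simp [ENNReal.toReal_pow, Real.pi_pos.le]

lemma mFourier_toTorus (j : Fin k → ℤ) (θ : Fin k → ℝ) :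
    mFourier j (toTorus θ) = Complex.exp (Complex.I * ((∑ t, (j t : ℝ) * θ t : ℝ) : ℂ)) := by
  simp only [mFourier, ContinuousMap.coe_mk, toTorus, fourier_coe_apply]
  rw [← Complex.exp_sum]
  congr 1
  push_cast
  rw [Finset.mul_sum]
  refine Finset.sum_congr rfl fun i _ => ?_
  have := Real.pi_ne_zero
  field_simp

lemma fourierCoefficient_eq_coeff {f : (Fin k → ℝ) → ℂ} (hf : IntegrableOn f (cube k))
    (j : Fin k → ℤ) : fourierCoefficient f j = coeff (f ∘ fromTorus) j := by
  have h := setIntegral_comp_toTorus (fun _ => -Real.pi)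
    (integrable_mFourier_mul (integrable_comp_fromTorus hf) j).aestronglyMeasurable
  rw [← cube_eq] at h
  rw [fourierCoefficient, coeff, one_div, inv_mul_eq_iff_eq_mul₀ (by simp [Real.pi_ne_zero]), ← h]
  refine integral_congr_ae ?_
  filter_upwards [fromTorus_toTorus_ae k] with θ hθ
  rw [mFourier_toTorus, Function.comp_apply, hθ, mul_comm]

lemma multiAntiIdentity_mul_toeplitz (f : (Fin k → ℝ) → ℂ) (n : Fin k → ℕ) :
    multiAntiIdentity n * toeplitz f n = hankel (fourierCoefficient f) n := by
  ext l h
  have hT : ∀ l h : MultiIndex n,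
      toeplitz f n l h = fourierCoefficient f (l.toInt - h.toInt) := fun l h => by
    rw [toeplitz, Matrix.sum_apply, Finset.sum_eq_single (l.toInt - h.toInt)]
    · simp [tensorProd, shiftMatrix, MultiIndex.toInt]
    · intro j _ hj
      obtain ⟨i, hi⟩ := Function.ne_iff.mp hj
      rw [Matrix.smul_apply, tensorProd, Matrix.of_apply, Finset.prod_eq_zero (Finset.mem_univ i),
        smul_zero]
      rw [shiftMatrix, Matrix.of_apply, if_neg]
      exact fun h => hi h.symm
    · intro hn
      refine absurd (Fintype.mem_piFinset.mpr fun i => ?_) hn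
      have h1 := (l i).isLt
      have h2 := (h i).isLt
      rw [Finset.mem_Ioo]
      simp only [Pi.sub_apply, MultiIndex.toInt]
      omega
  rw [Matrix.mul_apply, Finset.sum_eq_single l.rev]
  · rw [hT]
    simp [multiAntiIdentity, tensorProd, antiIdentity, MultiIndex.rev, hankel]
  · intro m _ hm
    obtain ⟨i, hi⟩ := Function.ne_iff.mp hm
    rw [multiAntiIdentity, tensorProd, Matrix.of_apply, Finset.prod_eq_zero (Finset.mem_univ i),
      zero_mul]
    rw [antiIdentity, Matrix.of_apply]
    exact if_neg hi
  · simp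

/-! ### The distribution of the symbol over the double cube -/

lemma restrict_doubleCube (hk : 0 < k) :
    (volume : Measure (Fin k → ℝ)).restrict (doubleCube k) =
      volume.restrict (Set.Icc (fun _ => -(2 * Real.pi)) fun _ => 0) +
        volume.restrict (Set.Icc (fun _ => 0) fun _ => 2 * Real.pi) := by
  refine Measure.restrict_union₀ ?_ measurableSet_Icc.nullMeasurableSet
  have : Nonempty (Fin k) := ⟨⟨0, hk⟩⟩
  refine measure_mono_null (fun θ hθ => ?_) (measure_singleton (0 : Fin k → ℝ))
  exact le_antisymm hθ.1.2 hθ.2.1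

lemma psi_ae_eq_right (g : UnitAddTorus (Fin k) → ℝ) :
    psi (fun θ => (g (toTorus θ) : ℂ)) =ᵐ[volume.restrict
      (Set.Icc (fun _ => 0) fun _ => 2 * Real.pi)] fun θ => (g (toTorus θ) : ℂ) :=
  (ae_restrict_mem measurableSet_Icc).mono fun _ hθ => if_pos hθ

lemma psi_ae_eq_left (hk : 0 < k) (g : UnitAddTorus (Fin k) → ℝ) :
    psi (fun θ => (g (toTorus θ) : ℂ)) =ᵐ[volume.restrict
      (Set.Icc (fun _ => -(2 * Real.pi)) fun _ => 0)] fun θ => -(g (toTorus θ) : ℂ) := by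
  have : Nonempty (Fin k) := ⟨⟨0, hk⟩⟩
  have h0 : ∀ᵐ θ ∂volume.restrict (Set.Icc (fun _ : Fin k => -(2 * Real.pi)) fun _ => 0),
      θ ≠ 0 := ae_restrict_of_ae (Measure.ae_ne volume 0)
  filter_upwards [ae_restrict_mem measurableSet_Icc, h0] with θ hθ hne
  rw [psi, if_neg fun h => hne (le_antisymm hθ.2 h.1), toTorus_add_two_pi]

/-- The distribution of the flipped Toeplitz matrices. All data factor through the torus: there
the matrices are the Hankel matrices of `f ∘ fromTorus`, and each half of the double cube is mapped
onto the torus with constant density. -/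
lemma hasEigenvalueDistribution_flip_toeplitz (hk : 0 < k) {f : (Fin k → ℝ) → ℂ}
    (hf : IntegrableOn f (cube k)) (hreal : ∀ j, (fourierCoefficient f j).im = 0) :
    HasEigenvalueDistribution (fun n => multiAntiIdentity n * toeplitz f n) (doubleCube k)
      (psi fun θ => ((‖periodicExt f θ‖ : ℝ) : ℂ)) := by
  set g : UnitAddTorus (Fin k) → ℂ := f ∘ fromTorus with hgdef
  have hg : Integrable g := integrable_comp_fromTorus hf
  have hcoeff : fourierCoefficient f = coeff g := funext (fourierCoefficient_eq_coeff hf)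
  have hgreal : ∀ j, (coeff g j).im = 0 := fun j => hcoeff ▸ hreal j
  have hψ : (psi fun θ => ((‖periodicExt f θ‖ : ℝ) : ℂ)) =
      psi fun θ : Fin k → ℝ => ((‖g (toTorus θ)‖ : ℝ) : ℂ) := by
    simp only [periodicExt_eq, hgdef, Function.comp_apply]
  have hleft := psi_ae_eq_left hk fun x => ‖g x‖
  have hright := psi_ae_eq_right (k := k) fun x => ‖g x‖
  have hπl := measurePreserving_toTorus (k := k) fun _ => -(2 * Real.pi)
  have hπr := measurePreserving_toTorus (k := k) fun _ => 0
  simp only [neg_add_cancel] at hπl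
  simp only [zero_add] at hπr
  have hvol : (volume : Measure (Fin k → ℝ)) (doubleCube k) =
      2 * ENNReal.ofReal (2 * Real.pi) ^ k := by
    have h1 := hπl.measure_preimage MeasurableSet.univ.nullMeasurableSet
    have h2 := hπr.measure_preimage MeasurableSet.univ.nullMeasurableSet
    rw [Set.preimage_univ] at h1 h2
    rw [← Measure.restrict_apply_univ, restrict_doubleCube hk, Measure.add_apply, h1, h2]
    simp [two_mul]
  have hgm : AEMeasurable (fun x => ((‖g x‖ : ℝ) : ℂ)) :=
    Complex.measurable_ofReal.comp_aemeasurable hg.aestronglyMeasurable.norm.aemeasurable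
  have hgm' : AEMeasurable (fun x => ((‖g x‖ : ℝ) : ℂ))
      (ENNReal.ofReal (2 * Real.pi) ^ k • volume) := hgm.smul_measure _
  rw [hψ]
  refine ⟨measurableSet_Icc.union measurableSet_Icc, ?_, ?_, ?_, fun F hF hFs => ?_⟩
  · rw [hvol]
    have := Real.pi_pos
    positivity
  · rw [hvol]
    finiteness
  · rw [restrict_doubleCube hk, aemeasurable_add_measure_iff]
    exact ⟨(hgm'.comp_quasiMeasurePreserving hπl.quasiMeasurePreserving).neg.congr hleft.symm,
      (hgm'.comp_quasiMeasurePreserving hπr.quasiMeasurePreserving).congr hright.symm⟩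
  · simp only [multiAntiIdentity_mul_toeplitz, hcoeff]
    convert tendsto_eigenvalueSum_hankel hk hg hgreal hF hFs using 2
    obtain ⟨C, hC⟩ := hF.bounded_above_of_compact_support hFs
    have hFr : AEStronglyMeasurable (fun x => F (‖g x‖ : ℂ)) :=
      hF.comp_aestronglyMeasurable hgm.aestronglyMeasurable
    have hFl : AEStronglyMeasurable (fun x => F (-(‖g x‖ : ℂ))) :=
      hF.comp_aestronglyMeasurable hgm.neg.aestronglyMeasurable
    have hleftF : (fun θ => F (psi (fun θ : Fin k → ℝ => ((‖g (toTorus θ)‖ : ℝ) : ℂ)) θ))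
        =ᵐ[volume.restrict (Set.Icc (fun _ => -(2 * Real.pi)) fun _ => 0)]
        fun θ => F (-(‖g (toTorus θ)‖ : ℂ)) := hleft.fun_comp F
    have hrightF : (fun θ => F (psi (fun θ : Fin k → ℝ => ((‖g (toTorus θ)‖ : ℝ) : ℂ)) θ))
        =ᵐ[volume.restrict (Set.Icc (fun _ => 0) fun _ => 2 * Real.pi)]
        fun θ => F (‖g (toTorus θ)‖ : ℂ) := hright.fun_comp F
    have hil := setIntegral_comp_toTorus (fun _ => -(2 * Real.pi)) hFl
    have hir := setIntegral_comp_toTorus (fun _ => 0) hFr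
    simp only [neg_add_cancel] at hil
    simp only [zero_add] at hir
    have hint : ∀ (a : Fin k → ℝ) {H : UnitAddTorus (Fin k) → ℂ}, AEStronglyMeasurable H →
        (∀ x, ‖H x‖ ≤ C) →
        IntegrableOn (fun θ => H (toTorus θ)) (Set.Icc a fun i => a i + 2 * Real.pi) :=
      fun a {H} hH hb => (measurePreserving_toTorus a).integrable_comp_of_integrable
        ((Integrable.of_bound hH C (.of_forall hb)).smul_measure (by finiteness))
    have hl := hint (fun _ => -(2 * Real.pi)) hFl fun _ => hC _
    have hr := hint (fun _ => 0) hFr fun _ => hC _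
    simp only [neg_add_cancel] at hl
    simp only [zero_add] at hr
    rw [eta, restrict_doubleCube hk, integral_add_measure (hl.congr hleftF.symm)
      (hr.congr hrightF.symm), integral_congr_ae hleftF, integral_congr_ae hrightF]
    rw [hil, hir, hvol, ENNReal.toReal_mul, ENNReal.toReal_pow,
      ENNReal.toReal_ofReal Real.two_pi_pos.le]
    have hpi : (Real.pi : ℂ) ≠ 0 := by exact_mod_cast Real.pi_ne_zero
    push_cast
    field_simp
    simp only [ENNReal.toReal_ofNat]
    push_cast
    ring

end

end MultilevelToeplitz

theorem theorem3p4 (k : ℕ) (hk : 1 ≤ k) (f : (Fin k → ℝ) → ℂ)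
    (hf : MeasureTheory.IntegrableOn f (MultilevelToeplitz.cube k) MeasureTheory.volume)
    (hreal : ∀ j : Fin k → ℤ, (MultilevelToeplitz.fourierCoefficient f j).im = 0) :
    MultilevelToeplitz.HasEigenvalueDistribution
      (fun n => MultilevelToeplitz.multiAntiIdentity n * MultilevelToeplitz.toeplitz f n)
      (MultilevelToeplitz.doubleCube k)
      (MultilevelToeplitz.psi
        (fun θ => ((‖MultilevelToeplitz.periodicExt f θ‖ : ℝ) : ℂ))) :=
  MultilevelToeplitz.hasEigenvalueDistribution_flip_toeplitz hk hf hreal
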